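/- Let $\gamma$ be Euler's constant and let $G$ be Barnes' $G$-function, the entire function given by $$G(z+1)=(2\pi)^{z/2}\,e^{-((1+\gamma)z^2+z)/2}\prod_{k=1}^{\infty}\Bigl(1+\frac zk\Bigr)^{k}e^{-z+z^2/(2k)} .$$ For $w\in\mathbb C\setminus(-\infty,0]$ let $\log G(w)$ denote the holomorphic branch of the logarithm of $G$ that is real for $w>0$; explicitly, for $z\in\mathbb C\setminus(-\infty,-1]$ and with the principal logarithm on the right, $$\log G(z+1)=\frac z2\log(2\pi)-\frac{(1+\gamma)z^2+z}{2}+\sum_{k=1}^{\infty}\Bigl(k\log\Bigl(1+\frac zk\Bigr)-z+\frac{z^2}{2k}\Bigr).$$ Then there is a measurable function $d:(0,\infty)\to(0,\infty)$ such that for every $z\in\mathbb C\setminus(-\infty,0]$ the function $t\mapsto d(t)/(t+z)$ is integrable on $(0,\infty)$ and $$\frac{\log G(z+1)}{z^2\log z}=\frac12-\int_0^\infty\frac{d(t)}{t+z}\,dt ,$$ where $\log z$ is the principal logarithm and, at the removable singularity $z=1$, the left-hand side is understood as its limit as $z\to1$. Moreover, $z\mapsto \log G(z+1)/(z^2\log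 z)$ is a Nevanlinna–Pick function, i.e. it is holomorphic in the open upper half-plane with values in the closed upper half-plane. -/

import Mathlib

/-- Barnes' `G`-function, given by its Weierstrass product: with `z = w - 1`,
`G(z + 1) = (2π)^(z/2) * exp (-((1 + γ) z² + z) / 2) *
  ∏_{k ≥ 1} (1 + z / k)^k * exp (-z + z² / (2k))`.
The product index is shifted, so `k + 1` plays the role of the positive integer `k`. -/
noncomputable def barnesG (w : ℂ) : ℂ :=
  (2 * (Real.pi : ℂ)) ^ ((w - 1) / 2) *
    Complex.exp (-((1 + (Real.eulerMascheroniConstant : ℂ)) * (w - 1) ^ 2 + (w - 1)) / 2) *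
    ∏' k : ℕ, ((1 + (w - 1) / ((k : ℂ) + 1)) ^ (k + 1) *
      Complex.exp (-(w - 1) + (w - 1) ^ 2 / (2 * ((k : ℂ) + 1))))

/-- The general term of the series defining `log G` (see `logBarnesG`). -/
noncomputable def logBarnesGTerm (k : ℕ) (w : ℂ) : ℂ :=
  ((k : ℂ) + 1) * Complex.log (1 + (w - 1) / ((k : ℂ) + 1)) - (w - 1) +
    (w - 1) ^ 2 / (2 * ((k : ℂ) + 1))

/-- The holomorphic branch of `log G` on `ℂ ∖ (-∞, 0]` that is real on the positive half-line,
obtained by taking principal logarithms of the factors of the Weierstrass product.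
That it is such a branch is shown in `exp_logBarnesG`, `differentiableOn_logBarnesG` and
`logBarnesG_ofReal_im`. -/
noncomputable def logBarnesG (w : ℂ) : ℂ :=
  (w - 1) / 2 * (Real.log (2 * Real.pi) : ℂ) -
    ((1 + (Real.eulerMascheroniConstant : ℂ)) * (w - 1) ^ 2 + (w - 1)) / 2 +
    ∑' k : ℕ, logBarnesGTerm k w

theorem one_add_div_mem_slitPlane {w : ℂ} (hw : w ∈ Complex.slitPlane) (k : ℕ) :
    1 + (w - 1) / ((k : ℂ) + 1) ∈ Complex.slitPlane := by
  have hk : (0 : ℝ) < (k : ℝ) + 1 := by positivity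
  have hk' : ((k : ℂ) + 1) ≠ 0 := by exact_mod_cast hk.ne'
  have e : 1 + (w - 1) / ((k : ℂ) + 1) = (((k : ℝ) + 1)⁻¹ : ℝ) * (w + (k : ℝ)) := by
    push_cast
    field_simp
    ring
  have hi : (0 : ℝ) < ((k : ℝ) + 1)⁻¹ := by positivity
  rw [e, Complex.mem_slitPlane_iff]
  rw [Complex.mem_slitPlane_iff] at hw
  rw [Complex.re_ofReal_mul, Complex.im_ofReal_mul]
  simp only [Complex.add_re, Complex.ofReal_re, Complex.add_im, Complex.ofReal_im, add_zero]
  rcases hw with h | h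
  · left
    positivity
  · right
    exact mul_ne_zero hi.ne' h

theorem norm_logBarnesGTerm_le {R : ℝ} {w : ℂ} (hw : ‖w - 1‖ ≤ R) {k : ℕ} (hk : 2 * R ≤ k) :
    ‖logBarnesGTerm k w‖ ≤ R ^ 3 * (1 / ((k : ℝ) + 1) ^ 2) := by
  have hk0 : (0 : ℝ) < (k : ℝ) + 1 := by positivity
  have hk' : ((k : ℂ) + 1) ≠ 0 := by exact_mod_cast hk0.ne'
  have hn : ‖(k : ℂ) + 1‖ = (k : ℝ) + 1 := by
    rw [show ((k : ℂ) + 1) = (((k : ℝ) + 1 : ℝ) : ℂ) by push_cast; rfl, Complex.norm_real,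
      Real.norm_of_nonneg hk0.le]
  have hR : 0 ≤ R := (norm_nonneg _).trans hw
  have hu : ‖(w - 1) / ((k : ℂ) + 1)‖ ≤ R / ((k : ℝ) + 1) := by
    rw [norm_div, hn]
    gcongr
  have hu2 : R / ((k : ℝ) + 1) ≤ 1 / 2 := by
    rw [div_le_iff₀ hk0]
    linarith
  set u := (w - 1) / ((k : ℂ) + 1) with hudef
  have hlt : ‖u‖ < 1 := by linarith
  have key := Complex.norm_log_sub_logTaylor_le 2 hlt
  have ht : Complex.logTaylor (2 + 1) u = u - u ^ 2 / 2 := by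
    simp [Complex.logTaylor, Finset.sum_range_succ]
    ring
  rw [ht] at key
  have e : logBarnesGTerm k w = ((k : ℂ) + 1) * (Complex.log (1 + u) - (u - u ^ 2 / 2)) := by
    rw [logBarnesGTerm, ← hudef]
    have : w - 1 = u * ((k : ℂ) + 1) := by rw [hudef]; field_simp
    rw [this]
    field_simp
    ring
  have hinv : (1 - ‖u‖)⁻¹ ≤ 2 := by
    rw [inv_le_comm₀ (by linarith) two_pos]
    linarith
  have hb : ‖u‖ ^ (2 + 1) * (1 - ‖u‖)⁻¹ / ((2 : ℕ) + 1) ≤ (R / ((k : ℝ) + 1)) ^ 3 := by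
    have h3 : ‖u‖ ^ 3 ≤ (R / ((k : ℝ) + 1)) ^ 3 := by gcongr
    have : ‖u‖ ^ 3 * (1 - ‖u‖)⁻¹ ≤ ‖u‖ ^ 3 * 2 := by gcongr
    have h0 : 0 ≤ ‖u‖ ^ 3 := by positivity
    push_cast
    norm_num
    linarith
  rw [e, norm_mul, hn]
  calc ((k : ℝ) + 1) * ‖Complex.log (1 + u) - (u - u ^ 2 / 2)‖
      ≤ ((k : ℝ) + 1) * (R / ((k : ℝ) + 1)) ^ 3 := by
        gcongr
        exact key.trans hb
    _ = R ^ 3 * (1 / ((k : ℝ) + 1) ^ 2) := by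
        field_simp

theorem summable_logBarnesG_bound (R : ℝ) :
    Summable fun k : ℕ => R ^ 3 * (1 / ((k : ℝ) + 1) ^ 2) := by
  apply Summable.mul_left
  have h := (summable_nat_add_iff (f := fun n : ℕ => 1 / (n : ℝ) ^ 2) 1).2
    (Real.summable_one_div_nat_pow.2 one_lt_two)
  simpa using h

theorem eventually_two_mul_le (R : ℝ) :
    ∀ᶠ k : ℕ in Filter.cofinite, 2 * R ≤ (k : ℝ) := by
  rw [Nat.cofinite_eq_atTop]
  exact tendsto_natCast_atTop_atTop.eventually_ge_atTop _

/-- The series defining `log G` converges absolutely. -/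
theorem summable_logBarnesGTerm (w : ℂ) : Summable fun k => logBarnesGTerm k w := by
  refine (summable_logBarnesG_bound ‖w - 1‖).of_norm_bounded_eventually ?_
  filter_upwards [eventually_two_mul_le ‖w - 1‖] with k hk
  exact norm_logBarnesGTerm_le le_rfl hk

theorem exp_logBarnesG {w : ℂ} (hw : w ∈ Complex.slitPlane) :
    Complex.exp (logBarnesG w) = barnesG w := by
  have hpi : (2 * (Real.pi : ℂ)) ≠ 0 := by
    exact_mod_cast (by positivity : (2 * Real.pi) ≠ 0)
  have hprod : Complex.exp (∑' k : ℕ, logBarnesGTerm k w) =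
      ∏' k : ℕ, ((1 + (w - 1) / ((k : ℂ) + 1)) ^ (k + 1) *
        Complex.exp (-(w - 1) + (w - 1) ^ 2 / (2 * ((k : ℂ) + 1)))) := by
    refine ((summable_logBarnesGTerm w).hasSum.cexp.tprod_eq.symm).trans (tprod_congr fun k => ?_)
    have h0 := Complex.slitPlane_ne_zero (one_add_div_mem_slitPlane hw k)
    simp only [Function.comp_apply, logBarnesGTerm]
    rw [sub_add, sub_eq_add_neg, Complex.exp_add]
    congr 1
    · rw [show ((k : ℂ) + 1) * Complex.log (1 + (w - 1) / ((k : ℂ) + 1)) =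
        ((k + 1 : ℕ) : ℂ) * Complex.log (1 + (w - 1) / ((k : ℂ) + 1)) by push_cast; rfl,
        Complex.exp_nat_mul, Complex.exp_log h0]
    · congr 1
      ring
  rw [logBarnesG, barnesG, Complex.exp_add, hprod, sub_eq_add_neg, Complex.exp_add,
    Complex.cpow_def_of_ne_zero hpi, Complex.ofReal_log (by positivity)]
  push_cast
  ring_nf

theorem differentiableOn_logBarnesG : DifferentiableOn ℂ logBarnesG Complex.slitPlane := by
  have hterm : ∀ k : ℕ, DifferentiableOn ℂ (logBarnesGTerm k) Complex.slitPlane := by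
    intro k w hw
    have h := one_add_div_mem_slitPlane hw k
    have h1 : DifferentiableAt ℂ (fun w : ℂ => Complex.log (1 + (w - 1) / ((k : ℂ) + 1))) w :=
      DifferentiableAt.clog (by fun_prop) h
    have h2 : DifferentiableAt ℂ (logBarnesGTerm k) w := by
      unfold logBarnesGTerm
      fun_prop
    exact h2.differentiableWithinAt
  have hsum : DifferentiableOn ℂ (fun w => ∑' k : ℕ, logBarnesGTerm k w)
      Complex.slitPlane := by
    intro w hw
    let U : Set ℂ := Metric.ball 1 (‖w - 1‖ + 1) ∩ Complex.slitPlane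
    have hU : IsOpen U := Metric.isOpen_ball.inter Complex.isOpen_slitPlane
    have hwU : w ∈ U := ⟨by rw [mem_ball_iff_norm]; linarith, hw⟩
    have hc : TendstoUniformlyOn (fun (s : Finset ℕ) (w : ℂ) => ∑ k ∈ s, logBarnesGTerm k w)
        (fun w => ∑' k : ℕ, logBarnesGTerm k w) Filter.atTop U := by
      refine tendstoUniformlyOn_tsum_of_cofinite_eventually
        (summable_logBarnesG_bound (‖w - 1‖ + 1)) ?_
      filter_upwards [eventually_two_mul_le (‖w - 1‖ + 1)] with k hk x hx
      exact norm_logBarnesGTerm_le (mem_ball_iff_norm.1 hx.1).le hk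
    have hd : DifferentiableOn ℂ (fun w => ∑' k : ℕ, logBarnesGTerm k w) U := by
      refine hc.tendstoLocallyUniformlyOn.differentiableOn
        (Filter.Eventually.of_forall fun s => ?_) hU
      exact DifferentiableOn.fun_sum fun i _ => (hterm i).mono Set.inter_subset_right
    exact (hd.differentiableAt (hU.mem_nhds hwU)).differentiableWithinAt
  unfold logBarnesG
  exact DifferentiableOn.add (by fun_prop) hsum

theorem logBarnesG_ofReal_im {x : ℝ} (hx : 0 < x) : (logBarnesG (x : ℂ)).im = 0 := by
  have hterm : ∀ k : ℕ, logBarnesGTerm k (x : ℂ) =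
      ((((k : ℝ) + 1) * Real.log (1 + (x - 1) / ((k : ℝ) + 1)) - (x - 1) +
        (x - 1) ^ 2 / (2 * ((k : ℝ) + 1)) : ℝ) : ℂ) := by
    intro k
    have hk : (0 : ℝ) < (k : ℝ) + 1 := by positivity
    have h : 0 ≤ 1 + (x - 1) / ((k : ℝ) + 1) := by
      have : 1 + (x - 1) / ((k : ℝ) + 1) = (x + k) / ((k : ℝ) + 1) := by
        field_simp
        ring
      rw [this]
      positivity
    rw [logBarnesGTerm]
    push_cast [Complex.ofReal_log h]
    rfl
  have hreal : logBarnesG (x : ℂ) =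
      (((x - 1) / 2 * Real.log (2 * Real.pi) -
        ((1 + Real.eulerMascheroniConstant) * (x - 1) ^ 2 + (x - 1)) / 2 +
        ∑' k : ℕ, (((k : ℝ) + 1) * Real.log (1 + (x - 1) / ((k : ℝ) + 1)) - (x - 1) +
        (x - 1) ^ 2 / (2 * ((k : ℝ) + 1))) : ℝ) : ℂ) := by
    rw [logBarnesG, tsum_congr hterm, ← Complex.ofReal_tsum]
    push_cast
    rfl
  rw [hreal, Complex.ofReal_im]

/-- A Nevanlinna--Pick function: holomorphic in the open upper half-plane, with values in the
closed upper half-plane. -/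
def IsNevanlinnaPick (f : ℂ → ℂ) : Prop :=
  DifferentiableOn ℂ f {z : ℂ | 0 < z.im} ∧ ∀ z : ℂ, 0 < z.im → 0 ≤ (f z).im

/-! Write `f z = log G(1 + z) / (z² log z)`. It is holomorphic on the plane cut along `(-∞, 0]`, the
singularity at `z = 1` being removable because `log G(2) = 0` (`logBarnesG_two`), and it satisfies
`f (conj z) = conj (f z)`. Cauchy's formula on the cut plane expresses `f` through the jump across
the cut, which is `2i` times the imaginary part of the boundary value from above. Hence the density
must be `Im f(-t + i0) / π`, and three facts are needed.

Positivity: for `n < t < n + 1` the boundary value of `log G(1 - t)` has imaginary part `π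
n(n+1)/2`. Multiplying by the conjugate of `log(-t) = log t + iπ`, positivity of `Im f` becomes `Re
log G(1 - t) < n(n+1)/2 · log t` (`re_logBarnesG_one_sub_lt`). This follows by induction on `n` from
`G(z + 1) = Γ(z) G(z)`, the reflection formula and `Γ(t) ≤ t^(n+1)`.

Behaviour at infinity: `log G(1 + ζ) = (ζ²/2) log ζ + O(ζ²)` uniformly on the circles `|ζ| = N +
1/2` (`exists_norm_logBarnesG_sub_le`), so `f → 1/2` there. This is the constant term of the
representation.

Behaviour at the origin: `log G(1 + ζ) = O(ζ)`, so small circles contribute nothing in the limit.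

Cauchy's theorem is applied in the variable `u = log z`, where the cut plane is the strip `|Im u| <
π` and the contours are rectangles. Logarithmic singularities at `z = -1, -2, …` lie on the cut and
are integrable, so dominated convergence carries the horizontal edges to the cut
(`tendsto_horizontal`, `barnesQuotient_eq`). Positivity of the density turns the limit over compact
intervals into an absolutely convergent integral, and the Nevanlinna–Pick property is read off from
it. -/

/-! ### Symmetry, continuity up to the cut from above, measurability. -/

theorem logBarnesG_one : logBarnesG 1 = 0 := by
  simp [logBarnesG, logBarnesGTerm]

theorem conj_logBarnesG {w : ℂ} (hw : w ∈ Complex.slitPlane) :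
    logBarnesG (starRingEnd ℂ w) = starRingEnd ℂ (logBarnesG w) := by
  have hterm (k : ℕ) : logBarnesGTerm k (starRingEnd ℂ w) =
      starRingEnd ℂ (logBarnesGTerm k w) := by
    have h : Complex.log (1 + (starRingEnd ℂ w - 1) / ((k : ℂ) + 1)) =
        starRingEnd ℂ (Complex.log (1 + (w - 1) / ((k : ℂ) + 1))) := by
      rw [← Complex.log_conj _ (Complex.slitPlane_arg_ne_pi (one_add_div_mem_slitPlane hw k))]
      simp
    simp [logBarnesGTerm, h, map_ofNat]
  simp only [logBarnesG, hterm, ← Complex.conj_tsum]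
  simp [Complex.conj_ofReal, map_ofNat]

/-- The closed upper half-plane without the points `0, -1, -2, …`. -/
def closedUpperMinusPoles : Set ℂ := {w : ℂ | 0 ≤ w.im ∧ ∀ k : ℕ, w + k ≠ 0}

theorem one_add_div_eq (w : ℂ) (k : ℕ) :
    1 + (w - 1) / ((k : ℂ) + 1) = (((k : ℝ) + 1)⁻¹ : ℝ) * (w + (k : ℝ)) := by
  have hk' : ((k : ℂ) + 1) ≠ 0 := by exact_mod_cast k.succ_ne_zero
  push_cast
  field_simp
  ring

/-- As `arg` takes values in `(-π, π]`, the principal logarithm is continuous up to the negative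
axis from above; its value on the cut is therefore the boundary value from the upper half-plane. -/
theorem continuousOn_logBarnesGTerm (k : ℕ) :
    ContinuousOn (logBarnesGTerm k) closedUpperMinusPoles := by
  have hi : (0 : ℝ) < ((k : ℝ) + 1)⁻¹ := by positivity
  have hlog : ContinuousOn (fun w : ℂ => Complex.log (1 + (w - 1) / ((k : ℂ) + 1)))
      closedUpperMinusPoles := by
    have hmaps : Set.MapsTo (fun w : ℂ => 1 + (w - 1) / ((k : ℂ) + 1)) closedUpperMinusPoles
        {z : ℂ | 0 ≤ z.im ∧ z ≠ 0} := by
      intro w hw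
      simp only [one_add_div_eq, Set.mem_ofPred_eq, Complex.im_ofReal_mul]
      refine ⟨?_, mul_ne_zero (by exact_mod_cast hi.ne') (by exact_mod_cast hw.2 k)⟩
      simpa using mul_nonneg hi.le hw.1
    have hcl : ContinuousOn Complex.log {z : ℂ | 0 ≤ z.im ∧ z ≠ 0} := by
      intro z hz
      by_cases hs : z ∈ Complex.slitPlane
      · exact (continuousAt_clog hs).continuousWithinAt
      · rw [Complex.mem_slitPlane_iff, not_or, not_lt, not_not] at hs
        have hre : z.re < 0 := lt_of_le_of_ne hs.1 fun h => hz.2 (Complex.ext h hs.2)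
        exact (Complex.continuousWithinAt_log_of_re_neg_of_im_zero hre hs.2).mono fun _ h => h.1
    exact hcl.comp (by fun_prop) hmaps
  unfold logBarnesGTerm
  fun_prop

theorem tendstoUniformlyOn_logBarnesG_series (R : ℝ) :
    TendstoUniformlyOn (fun (s : Finset ℕ) (w : ℂ) => ∑ k ∈ s, logBarnesGTerm k w)
      (fun w => ∑' k : ℕ, logBarnesGTerm k w) Filter.atTop (Metric.ball 1 R) := by
  refine tendstoUniformlyOn_tsum_of_cofinite_eventually (summable_logBarnesG_bound R) ?_
  filter_upwards [eventually_two_mul_le R] with k hk x hx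
  exact norm_logBarnesGTerm_le (mem_ball_iff_norm.1 hx).le hk

theorem continuousOn_logBarnesG : ContinuousOn logBarnesG closedUpperMinusPoles := by
  have hsum : ContinuousOn (fun w => ∑' k : ℕ, logBarnesGTerm k w) closedUpperMinusPoles := by
    intro w hw
    have hc : ContinuousOn (fun w => ∑' k : ℕ, logBarnesGTerm k w)
        (closedUpperMinusPoles ∩ Metric.ball 1 (‖w - 1‖ + 1)) := by
      refine ((tendstoUniformlyOn_logBarnesG_series (‖w - 1‖ + 1)).mono
        Set.inter_subset_right).continuousOn (Filter.Frequently.of_forall fun s => ?_)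
      exact continuousOn_finsetSum _ fun k _ =>
        (continuousOn_logBarnesGTerm k).mono Set.inter_subset_left
    have hb : Metric.ball (1 : ℂ) (‖w - 1‖ + 1) ∈ nhds w :=
      Metric.isOpen_ball.mem_nhds (by rw [mem_ball_iff_norm]; linarith)
    exact (continuousWithinAt_inter hb).1 (hc w ⟨hw, mem_of_mem_nhds hb⟩)
  unfold logBarnesG
  exact ContinuousOn.add (by fun_prop) hsum

theorem measurable_logBarnesG : Measurable logBarnesG := by
  have hterm (k : ℕ) : Measurable (logBarnesGTerm k) := by
    unfold logBarnesGTerm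
    fun_prop
  have hsum : Measurable (fun w => ∑' k : ℕ, logBarnesGTerm k w) :=
    measurable_of_tendsto_metrizable
      (fun n : ℕ => Finset.measurable_fun_sum (Finset.range n) fun k _ => hterm k)
      (tendsto_pi_nhds.2 fun w => (summable_logBarnesGTerm w).hasSum.tendsto_sum_nat)
  unfold logBarnesG
  exact Measurable.add (by fun_prop) hsum

/-! ### `log G` on the real line and its functional equation. -/

/-- The real part of `logBarnesGTerm k (1 + z)` for real `z`. -/
noncomputable def reLogBarnesGTerm (k : ℕ) (z : ℝ) : ℝ :=
  ((k : ℝ) + 1) * Real.log (1 + z / ((k : ℝ) + 1)) - z + z ^ 2 / (2 * ((k : ℝ) + 1))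

theorem logBarnesGTerm_one_add_ofReal (k : ℕ) (z : ℝ) :
    logBarnesGTerm k (1 + z) = ((reLogBarnesGTerm k z : ℝ) : ℂ) +
      ((((k : ℝ) + 1) * Complex.arg ((1 + z / ((k : ℝ) + 1) : ℝ) : ℂ) : ℝ) : ℂ) * Complex.I := by
  have h : (1 + (1 + (z : ℂ) - 1) / ((k : ℂ) + 1)) = ((1 + z / ((k : ℝ) + 1) : ℝ) : ℂ) := by
    push_cast
    ring
  rw [logBarnesGTerm, h, Complex.log, Complex.norm_real, Real.norm_eq_abs, Real.log_abs,
    reLogBarnesGTerm]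
  push_cast
  ring

theorem re_logBarnesGTerm (k : ℕ) (z : ℝ) :
    (logBarnesGTerm k (1 + z)).re = reLogBarnesGTerm k z := by
  rw [logBarnesGTerm_one_add_ofReal, Complex.add_re, Complex.ofReal_re, Complex.re_ofReal_mul]
  simp

theorem im_logBarnesGTerm (k : ℕ) (z : ℝ) :
    (logBarnesGTerm k (1 + z)).im =
      ((k : ℝ) + 1) * Complex.arg ((1 + z / ((k : ℝ) + 1) : ℝ) : ℂ) := by
  rw [logBarnesGTerm_one_add_ofReal, Complex.add_im, Complex.ofReal_im, Complex.im_ofReal_mul]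
  simp

theorem summable_reLogBarnesGTerm (z : ℝ) : Summable fun k => reLogBarnesGTerm k z := by
  simpa only [Complex.reCLM_apply, re_logBarnesGTerm] using
    Complex.reCLM.summable (summable_logBarnesGTerm (1 + z))

theorem logBarnesG_one_add_ofReal (z : ℝ) :
    logBarnesG (1 + z) = ((z / 2 * Real.log (2 * Real.pi) -
      ((1 + Real.eulerMascheroniConstant) * z ^ 2 + z) / 2 : ℝ) : ℂ) +
      ∑' k : ℕ, logBarnesGTerm k (1 + z) := by
  rw [logBarnesG]
  push_cast
  ring

theorem re_logBarnesG (z : ℝ) : (logBarnesG (1 + z)).re = z / 2 * Real.log (2 * Real.pi) -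
      ((1 + Real.eulerMascheroniConstant) * z ^ 2 + z) / 2 + ∑' k : ℕ, reLogBarnesGTerm k z := by
  rw [logBarnesG_one_add_ofReal, Complex.add_re, Complex.ofReal_re,
    Complex.re_tsum (summable_logBarnesGTerm _)]
  simp only [re_logBarnesGTerm]

theorem im_logBarnesG (z : ℝ) : (logBarnesG (1 + z)).im =
    ∑' k : ℕ, ((k : ℝ) + 1) * Complex.arg ((1 + z / ((k : ℝ) + 1) : ℝ) : ℂ) := by
  rw [logBarnesG_one_add_ofReal, Complex.add_im, Complex.ofReal_im, zero_add,
    Complex.im_tsum (summable_logBarnesGTerm _)]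
  simp only [im_logBarnesGTerm]

/-- Exactly the factors `k < n` have a negative base; each has argument `π` and multiplicity `k +
1`. -/
theorem im_logBarnesG_one_sub {n : ℕ} {t : ℝ} (hn : (n : ℝ) < t) (ht : t < n + 1) :
    (logBarnesG (1 - t)).im = Real.pi * (n * (n + 1) / 2) := by
  have hs : ∀ k : ℕ, ((k : ℝ) + 1) * Complex.arg ((1 + -t / ((k : ℝ) + 1) : ℝ) : ℂ) =
      if k < n then ((k : ℝ) + 1) * Real.pi else 0 := by
    intro k
    have hk : (0 : ℝ) < (k : ℝ) + 1 := by positivity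
    have e : 1 + -t / ((k : ℝ) + 1) = (k + 1 - t) / (k + 1) := by field_simp; ring
    rw [e]
    split_ifs with h
    · have h' : (k : ℝ) + 1 ≤ n := by exact_mod_cast h
      rw [Complex.arg_ofReal_of_neg (div_neg_of_neg_of_pos (by linarith) hk)]
    · have h' : (n : ℝ) ≤ k := by exact_mod_cast not_lt.1 h
      rw [Complex.arg_ofReal_of_nonneg (div_nonneg (by linarith) hk.le), mul_zero]
  have h := im_logBarnesG (-t)
  rw [Complex.ofReal_neg, ← sub_eq_add_neg] at h
  rw [h, tsum_congr hs, tsum_eq_sum (s := Finset.range n) fun k hk => if_neg (by simpa using hk),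
    Finset.sum_congr rfl fun k hk => if_pos (Finset.mem_range.1 hk), ← Finset.sum_mul, mul_comm]
  congr 1
  clear hn ht hs h
  induction n with
  | zero => simp
  | succ n ih => rw [Finset.sum_range_succ, ih]; push_cast; ring

/-- Summation by parts: the summand is `(k+1)(log(z+k+1) - log(z+k)) - 1 + (z - 1/2)/(k+1)`. -/
theorem sum_reLogBarnesGTerm_sub {z : ℝ} (hz : ∀ k : ℕ, z + k ≠ 0)
    (n : ℕ) :
    ∑ k ∈ Finset.range n, (reLogBarnesGTerm k z - reLogBarnesGTerm k (z - 1)) =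
      n * Real.log (z + n) - Real.log (∏ j ∈ Finset.range n, (z + j)) - n +
        (z - 1 / 2) * (harmonic n : ℝ) := by
  induction n with
  | zero => simp
  | succ n ih =>
    have hn : (n : ℝ) + 1 ≠ 0 := by positivity
    have h1 : z + ((n : ℝ) + 1) ≠ 0 := by exact_mod_cast hz (n + 1)
    have e1 : 1 + z / ((n : ℝ) + 1) = (z + (n + 1)) / (n + 1) := by field_simp; ring
    have e2 : 1 + (z - 1) / ((n : ℝ) + 1) = (z + n) / (n + 1) := by field_simp; ring
    rw [Finset.sum_range_succ, ih, Finset.prod_range_succ, harmonic_succ,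
      Real.log_mul (Finset.prod_ne_zero_iff.2 fun j _ => hz j) (hz n), reLogBarnesGTerm,
      reLogBarnesGTerm, e1, e2, Real.log_div h1 hn, Real.log_div (hz n) hn]
    push_cast
    field_simp
    ring

theorem log_GammaSeq {z : ℝ} (hz : ∀ k : ℕ, z + k ≠ 0) {n : ℕ} (hn : n ≠ 0) :
    Real.log (Real.GammaSeq z n) = z * Real.log n + Real.log (n.factorial) -
      Real.log (∏ j ∈ Finset.range n, (z + j)) - Real.log (z + n) := by
  have hn' : (0 : ℝ) < n := by positivity
  have hp := Finset.prod_ne_zero_iff.2 fun j (_ : j ∈ Finset.range n) => hz j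
  rw [Real.GammaSeq, Finset.prod_range_succ, Real.log_div (by positivity) (mul_ne_zero hp (hz n)),
    Real.log_mul (by positivity) (by positivity), Real.log_rpow hn', Real.log_mul hp (hz n)]
  ring

theorem log_stirlingSeq {n : ℕ} (hn : n ≠ 0) :
    Real.log (Stirling.stirlingSeq n) = Real.log (n.factorial) - Real.log 2 / 2 -
      Real.log n / 2 - n * Real.log n + n := by
  have hn' : (0 : ℝ) < n := by positivity
  rw [Stirling.stirlingSeq, Real.log_div (by positivity) (by positivity),
    Real.log_mul (by positivity) (by positivity), Real.log_sqrt (by positivity),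
    Real.log_mul two_ne_zero hn'.ne', Real.log_pow, Real.log_div hn'.ne' (by positivity),
    Real.log_exp]
  ring

/-- The partial sums combine Euler's limit for `Γ`, Stirling's formula and `harmonic n - log n → γ`.
Since `Real.log` is `log |·|`, negative `z` is allowed, as needed on the cut. -/
theorem tsum_reLogBarnesGTerm_sub {z : ℝ} (hz : ∀ k : ℕ, z + k ≠ 0) :
    ∑' k : ℕ, reLogBarnesGTerm k z - ∑' k : ℕ, reLogBarnesGTerm k (z - 1) =
      z + Real.log (Real.Gamma z) - Real.log (2 * Real.pi) / 2 +
        (z - 1 / 2) * Real.eulerMascheroniConstant := by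
  have hG : Real.Gamma z ≠ 0 := Real.Gamma_ne_zero fun k h => hz k (by rw [h]; ring)
  have t1 := (Real.GammaSeq_tendsto_Gamma z).log hG
  have t2 := Stirling.tendsto_stirlingSeq_sqrt_pi.log (by positivity)
  have t3 := Real.tendsto_harmonic_sub_log.const_mul (z - 1 / 2)
  have t4 := (Real.tendsto_mul_log_one_add_div_atTop z).comp tendsto_natCast_atTop_atTop
  have t5 : Filter.Tendsto (fun n : ℕ => Real.log ((n : ℝ) + z) - Real.log n) Filter.atTop
      (nhds 0) := (Real.tendsto_log_comp_add_sub_log z).comp tendsto_natCast_atTop_atTop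
  -- This combination equals the partial sum exactly for `n ≠ 0`: all `log n` and `log n!` cancel,
  -- and `log 2 / 2` compensates the factor `√(2n)` in `stirlingSeq`.
  have key := ((((t1.sub t2).add t3).add t4).add t5).sub_const (Real.log 2 / 2)
  have hs := ((summable_reLogBarnesGTerm z).hasSum.sub
    (summable_reLogBarnesGTerm (z - 1)).hasSum).tendsto_sum_nat
  have := tendsto_nhds_unique hs (key.congr' ?_)
  · rw [this, Real.log_sqrt Real.pi_pos.le, Real.log_mul two_ne_zero Real.pi_ne_zero]
    ring
  filter_upwards [Filter.eventually_ne_atTop 0] with n hn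
  have hn' : (n : ℝ) ≠ 0 := by positivity
  have e : 1 + z / (n : ℝ) = (z + n) / n := by field_simp; ring
  rw [sum_reLogBarnesGTerm_sub hz, log_GammaSeq hz hn, log_stirlingSeq hn,
    Function.comp_apply, e, Real.log_div (hz n) hn', add_comm (n : ℝ) z]
  ring

/-- The functional equation `G (z + 1) = Γ z * G z` on the real line. -/
theorem re_logBarnesG_one_add {z : ℝ} (hz : ∀ k : ℕ, z + k ≠ 0) :
    (logBarnesG (1 + z)).re = (logBarnesG z).re + Real.log (Real.Gamma z) := by
  have h := re_logBarnesG (z - 1)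
  rw [Complex.ofReal_sub, Complex.ofReal_one, add_sub_cancel] at h
  rw [re_logBarnesG, h]
  linarith [tsum_reLogBarnesGTerm_sub hz]

/-! ### Positivity of the imaginary part on the cut. -/

theorem log_one_add_le_of_nonpos {u : ℝ} (h : -1 < u) (h0 : u ≤ 0) :
    Real.log (1 + u) ≤ u - u ^ 2 / 2 := by
  have hs := Real.hasSum_pow_div_log_of_abs_lt_one (x := -u)
    (by rw [abs_lt]; constructor <;> linarith)
  have := hs.summable.sum_le_tsum (Finset.range 2) fun i _ => by
    have : 0 ≤ -u := by linarith
    positivity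
  rw [hs.tsum_eq, Finset.sum_range_succ, Finset.sum_range_one, sub_neg_eq_add] at this
  norm_num at this
  linarith

theorem reLogBarnesGTerm_nonpos (k : ℕ) {z : ℝ} (h : -1 < z) (h0 : z ≤ 0) :
    reLogBarnesGTerm k z ≤ 0 := by
  have hk : (0 : ℝ) < (k : ℝ) + 1 := by positivity
  have h1 : -1 < z / ((k : ℝ) + 1) := by
    rw [lt_div_iff₀ hk]
    have : (0 : ℝ) ≤ k := by positivity
    linarith
  have := mul_le_mul_of_nonneg_left
    (log_one_add_le_of_nonpos h1 (div_nonpos_of_nonpos_of_nonneg h0 hk.le)) hk.le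
  have e : ((k : ℝ) + 1) * (z / ((k : ℝ) + 1) - (z / ((k : ℝ) + 1)) ^ 2 / 2) =
      z - z ^ 2 / (2 * ((k : ℝ) + 1)) := by field_simp
  rw [reLogBarnesGTerm]
  linarith

theorem one_lt_log_two_pi : 1 < Real.log (2 * Real.pi) := by
  rw [Real.lt_log_iff_exp_lt (by positivity)]
  linarith [Real.exp_one_lt_d9, Real.pi_gt_three]

/-- The series has nonpositive terms, and the rest is `-(t/2)(log 2π - 1) - (1 + γ)t²/2`. -/
theorem re_logBarnesG_one_sub_neg {t : ℝ} (h0 : 0 < t) (h1 : t < 1) :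
    (logBarnesG (1 - t)).re < 0 := by
  have h := re_logBarnesG (-t)
  rw [Complex.ofReal_neg, ← sub_eq_add_neg] at h
  have hs : ∑' k : ℕ, reLogBarnesGTerm k (-t) ≤ 0 :=
    tsum_nonpos fun k => reLogBarnesGTerm_nonpos k (by linarith) (by linarith)
  have hg := Real.one_half_lt_eulerMascheroniConstant
  rw [h]
  nlinarith [one_lt_log_two_pi, mul_pos h0 (sub_pos.2 one_lt_log_two_pi), sq_nonneg t]

/-- On `[1, 2]` convexity gives `Γ ≤ 1`; then `Γ(t) = (t - 1)Γ(t - 1)`. The exponent `n + 1` is the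
increment between consecutive triangular numbers in `re_logBarnesG_one_sub_lt`. -/
theorem Gamma_le_pow {n : ℕ} {t : ℝ} (hn : (n : ℝ) + 1 ≤ t) (ht : t ≤ n + 2) :
    Real.Gamma t ≤ t ^ (n + 1) := by
  induction n generalizing t with
  | zero =>
    norm_num at hn ht
    have := Real.convexOn_Gamma.2 (Set.mem_Ioi.2 one_pos) (Set.mem_Ioi.2 two_pos)
      (by linarith : 0 ≤ 2 - t) (by linarith : 0 ≤ t - 1) (by ring)
    simp only [smul_eq_mul, Real.Gamma_one, Real.Gamma_two] at this
    rw [show (2 - t) * 1 + (t - 1) * 2 = t by ring] at this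
    simp only [zero_add, pow_one]
    linarith
  | succ n ih =>
    push_cast at hn ht
    have h0 : (0 : ℝ) ≤ n := by positivity
    have := ih (t := t - 1) (by linarith) (by linarith)
    rw [← sub_add_cancel t 1, Real.Gamma_add_one (by linarith), sub_add_cancel,
      pow_succ' _ (n + 1)]
    have h1 : (t - 1) ^ (n + 1) ≤ t ^ (n + 1) := by gcongr <;> linarith
    have h2 : (0 : ℝ) ≤ t ^ (n + 1) := pow_nonneg (by linarith) _
    have h3 : 0 ≤ Real.Gamma (t - 1) := Real.Gamma_nonneg_of_nonneg (by linarith)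
    nlinarith

/-- By reflection `|Γ(t) Γ(1 - t)| = π / |sin πt| ≥ π > 1`. -/
theorem log_Gamma_one_sub {t : ℝ} (h0 : 0 < t) (ht : ∀ k : ℕ, t ≠ k) :
    -Real.log (Real.Gamma (1 - t)) < Real.log (Real.Gamma t) := by
  have hs := congrArg Real.log (Real.Gamma_mul_Gamma_one_sub t)
  have hsin : Real.sin (Real.pi * t) ≠ 0 := by
    rw [mul_comm, Ne, Real.sin_eq_zero_iff]
    rintro ⟨m, hm⟩
    have hm' : (m : ℝ) = t := mul_right_cancel₀ Real.pi_ne_zero hm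
    have : 0 < m := by exact_mod_cast hm'.symm ▸ h0
    obtain ⟨k, rfl⟩ := Int.eq_ofNat_of_zero_le this.le
    exact ht k (by simpa using hm'.symm)
  have hG : Real.Gamma (1 - t) ≠ 0 := Real.Gamma_ne_zero fun k h =>
    ht (k + 1) (by push_cast; linarith)
  rw [Real.log_mul (Real.Gamma_pos_of_pos h0).ne' hG, Real.log_div Real.pi_ne_zero hsin] at hs
  have h1 : Real.log (Real.sin (Real.pi * t)) ≤ 0 := by
    rw [← Real.log_abs]
    exact Real.log_nonpos (abs_nonneg _) (Real.abs_sin_le_one _)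
  have h2 : 0 < Real.log Real.pi := Real.log_pos (by linarith [Real.pi_gt_three])
  linarith

/-- Passing from `t - 1` to `t` subtracts `log |Γ(1 - t)|`, which costs less than `log Γ(t) ≤ (n +
1) log t`. -/
theorem re_logBarnesG_one_sub_lt {n : ℕ} {t : ℝ} (hn : (n : ℝ) < t) (ht : t < n + 1) :
    (logBarnesG (1 - t)).re < n * (n + 1) / 2 * Real.log t := by
  induction n generalizing t with
  | zero => simpa using re_logBarnesG_one_sub_neg (by simpa using hn) (by simpa using ht)
  | succ n ih =>
    push_cast at hn ht ⊢
    have hn0 : (0 : ℝ) ≤ n := by positivity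
    have hint (k : ℤ) : t ≠ k := by
      rintro rfl
      have h1 : ((n : ℤ) + 1) < k := by exact_mod_cast hn
      have h2 : k < ((n : ℤ) + 1 + 1) := by exact_mod_cast ht
      omega
    have hf := re_logBarnesG_one_add (z := 1 - t)
      (fun k h => hint (k + 1) (by push_cast; linarith))
    have ih' := ih (t := t - 1) (by linarith) (by linarith)
    push_cast at hf ih'
    rw [show (1 : ℂ) - (t - 1) = 1 + (1 - t) by ring] at ih'
    have hlog : Real.log (t - 1) ≤ Real.log t := Real.log_le_log (by linarith) (by linarith)
    have hG := Real.log_le_log (Real.Gamma_pos_of_pos (by linarith : 0 < t))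
      (Gamma_le_pow (n := n) hn.le (by linarith))
    rw [Real.log_pow] at hG
    push_cast at hG
    have := mul_le_mul_of_nonneg_left hlog (by positivity : 0 ≤ (n : ℝ) * (n + 1) / 2)
    linarith [log_Gamma_one_sub (by linarith : 0 < t) fun k => by exact_mod_cast hint k]

/-- The function represented by the main theorem. -/
noncomputable def barnesQuotient (z : ℂ) : ℂ := logBarnesG (z + 1) / (z ^ 2 * Complex.log z)

theorem log_neg_ofReal {t : ℝ} (ht : 0 < t) :
    Complex.log (-(t : ℂ)) = Real.log t + Real.pi * Complex.I := by
  rw [← Complex.ofReal_neg, Complex.log, Complex.norm_real, Complex.arg_ofReal_of_neg (by linarith)]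
  simp

theorem im_barnesQuotient_neg_pos {t : ℝ} (h0 : 0 < t) (ht : ∀ k : ℕ, t ≠ k) :
    0 < (barnesQuotient (-t)).im := by
  have hn := lt_of_le_of_ne (Nat.floor_le h0.le) (ht _).symm
  have hre := re_logBarnesG_one_sub_lt hn (Nat.lt_floor_add_one t)
  have him := im_logBarnesG_one_sub hn (Nat.lt_floor_add_one t)
  rw [barnesQuotient, log_neg_ofReal h0, show (-(t : ℂ) + 1) = 1 - t by ring,
    show (-(t : ℂ)) ^ 2 * (Real.log t + Real.pi * Complex.I) =
      ((t ^ 2 : ℝ) : ℂ) * (Real.log t + Real.pi * Complex.I) by push_cast; ring,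
    mul_comm ((t ^ 2 : ℝ) : ℂ), ← div_div, Complex.div_ofReal_im, Complex.div_im, him]
  have hns : 0 < Complex.normSq (Real.log t + Real.pi * Complex.I) := by
    rw [Complex.normSq_pos]
    intro h
    simpa using congrArg Complex.im h
  refine div_pos ?_ (by positivity)
  rw [← sub_div]
  refine div_pos ?_ hns
  simp only [Complex.add_re, Complex.ofReal_re, Complex.mul_re, Complex.I_re, mul_zero,
    Complex.ofReal_im, Complex.I_im, mul_one, sub_self, add_zero, Complex.add_im, Complex.mul_im,
    zero_add]
  nlinarith [mul_lt_mul_of_pos_left hre Real.pi_pos]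

/-! ### Growth of `log G` on circles. -/

theorem norm_tsum_logBarnesGTerm_add_le {R : ℝ} {ζ : ℂ} (hζ : ‖ζ‖ ≤ R) {K : ℕ} (hK : 2 * R ≤ K)
    (hK0 : 0 < K) : ‖∑' k : ℕ, logBarnesGTerm (k + K) (1 + ζ)‖ ≤ R ^ 3 / K := by
  have hR : 0 ≤ R := (norm_nonneg _).trans hζ
  have hK' : (0 : ℝ) < K := by exact_mod_cast hK0
  have hb (k : ℕ) : ‖logBarnesGTerm (k + K) (1 + ζ)‖ ≤
      R ^ 3 * (1 / (((k + K : ℕ) : ℝ) + 1) ^ 2) := by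
    refine norm_logBarnesGTerm_le (by simpa using hζ) (hK.trans ?_)
    push_cast
    linarith [(Nat.cast_nonneg k : (0 : ℝ) ≤ k)]
  have hsn : Summable fun k => ‖logBarnesGTerm (k + K) (1 + ζ)‖ :=
    ((summable_nat_add_iff K).2 (summable_logBarnesG_bound R)).of_nonneg_of_le
      (fun _ => norm_nonneg _) hb
  refine (norm_tsum_le_tsum_norm hsn).trans (Real.tsum_le_of_sum_range_le
    (fun _ => norm_nonneg _) fun n => ?_)
  have hn : ∑ k ∈ Finset.range n, ‖logBarnesGTerm (k + K) (1 + ζ)‖ ≤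
      R ^ 3 * (1 / K - 1 / (K + n)) := by
    induction n with
    | zero => simp
    | succ n ih =>
      rw [Finset.sum_range_succ]
      refine (add_le_add ih (hb n)).trans ?_
      rw [← mul_add]
      refine mul_le_mul_of_nonneg_left ?_ (by positivity)
      have h0 : (0 : ℝ) ≤ n := by positivity
      push_cast
      -- Telescoping majorant of the tail of `∑ 1/m²`.
      have h1 : 1 / ((n : ℝ) + K + 1) ^ 2 ≤ 1 / (K + n) - 1 / (K + (n + 1)) := by
        rw [div_sub_div _ _ (by positivity) (by positivity), div_le_div_iff₀ (by positivity)
          (by positivity)]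
        nlinarith
      linarith
  refine hn.trans ?_
  rw [div_eq_mul_one_div (R ^ 3)]
  refine mul_le_mul_of_nonneg_left ?_ (by positivity)
  have : (0 : ℝ) ≤ 1 / (K + n) := by positivity
  linarith

theorem norm_log_le (w : ℂ) : ‖Complex.log w‖ ≤ |Real.log ‖w‖| + Real.pi := by
  refine (Complex.norm_le_abs_re_add_abs_im _).trans ?_
  rw [Complex.log_re, Complex.log_im]
  gcongr
  exact Complex.abs_arg_le_pi w

/-- From `|1 - |ζ|/m| ≤ |1 + ζ/m| ≤ 1 + |ζ|/m`. The bound is independent of `arg ζ`, hence uniform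
up to the cut. -/
theorem norm_log_one_add_div_le {ζ : ℂ} {m : ℝ} (hm : 0 < m) (h : ‖ζ‖ ≠ m) :
    ‖Complex.log (1 + ζ / m)‖ ≤ |Real.log (1 - ‖ζ‖ / m)| + ‖ζ‖ / m + Real.pi := by
  have h1 : ‖1 + ζ / m‖ ≤ 1 + ‖ζ‖ / m := by
    simpa [abs_of_pos hm] using norm_add_le (1 : ℂ) (ζ / m)
  have h2 : |1 - ‖ζ‖ / m| ≤ ‖1 + ζ / m‖ := by
    simpa [abs_of_pos hm] using abs_norm_sub_norm_le (1 : ℂ) (-(ζ / m))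
  have h0 : 0 < |1 - ‖ζ‖ / m| := by
    rw [abs_pos, sub_ne_zero]
    intro e
    exact h ((div_eq_one_iff_eq hm.ne').1 e.symm)
  have hz : 0 ≤ ‖ζ‖ / m := by positivity
  have l1 := Real.log_le_log (h0.trans_le h2) h1
  have l2 := Real.log_le_log h0 h2
  have l3 := Real.log_le_sub_one_of_pos (by positivity : 0 < 1 + ‖ζ‖ / m)
  rw [Real.log_abs] at l2
  refine (norm_log_le _).trans (add_le_add_left (abs_le.2 ⟨?_, ?_⟩) _)
  · linarith [neg_abs_le (Real.log (1 - ‖ζ‖ / m))]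
  · linarith [abs_nonneg (Real.log (1 - ‖ζ‖ / m))]

theorem logBarnesG_one_add (K : ℕ) (ζ : ℂ) :
    logBarnesG (1 + ζ) = ζ / 2 * (Real.log (2 * Real.pi) : ℂ) -
      ((1 + (Real.eulerMascheroniConstant : ℂ)) * ζ ^ 2 + ζ) / 2 +
      (∑ k ∈ Finset.range K, ((k : ℂ) + 1) * Complex.log (1 + ζ / ((k + 1 : ℝ) : ℂ)) - K * ζ +
        ζ ^ 2 / 2 * ((harmonic K : ℝ) : ℂ)) + ∑' k : ℕ, logBarnesGTerm (k + K) (1 + ζ) := by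
  have hfin : ∑ k ∈ Finset.range K, logBarnesGTerm k (1 + ζ) =
      ∑ k ∈ Finset.range K, ((k : ℂ) + 1) * Complex.log (1 + ζ / ((k + 1 : ℝ) : ℂ)) - K * ζ +
        ζ ^ 2 / 2 * ((harmonic K : ℝ) : ℂ) := by
    induction K with
    | zero => simp
    | succ n ih =>
      have hn : (n : ℂ) + 1 ≠ 0 := by exact_mod_cast n.succ_ne_zero
      rw [Finset.sum_range_succ, ih, Finset.sum_range_succ, harmonic_succ, logBarnesGTerm]
      push_cast
      rw [add_sub_cancel_left]
      field_simp
      ring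
  rw [← hfin, logBarnesG, ← (summable_logBarnesGTerm (1 + ζ)).sum_add_tsum_nat_add K,
    add_sub_cancel_left]
  ring

theorem log_le_two_mul_sqrt {y : ℝ} (hy : 0 < y) : Real.log y ≤ 2 * √y := by
  have := Real.log_le_sub_one_of_pos (Real.sqrt_pos.2 hy)
  rw [Real.log_sqrt hy.le] at this
  linarith

theorem sum_inv_sqrt_le (n : ℕ) :
    ∑ j ∈ Finset.range n, 1 / √((j : ℝ) + 1 / 2) ≤ 4 * √n := by
  induction n with
  | zero => simp
  | succ n ih =>
    rw [Finset.sum_range_succ]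
    have hn : (0 : ℝ) ≤ n := by positivity
    have hs : 0 < √((n : ℝ) + 1 / 2) := Real.sqrt_pos.2 (by positivity)
    have h1 : √((n : ℝ) + 1) ≤ 2 * √((n : ℝ) + 1 / 2) := by
      rw [Real.sqrt_le_iff]
      refine ⟨by positivity, ?_⟩
      rw [mul_pow, Real.sq_sqrt (by positivity)]
      linarith
    have h2 : √(n : ℝ) ≤ 2 * √((n : ℝ) + 1 / 2) :=
      (Real.sqrt_le_sqrt (by linarith)).trans h1
    have h3 : (√((n : ℝ) + 1) - √n) * (√((n : ℝ) + 1) + √n) = 1 := by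
      linear_combination Real.sq_sqrt (by positivity : (0 : ℝ) ≤ (n : ℝ) + 1) - Real.sq_sqrt hn
    have h4 : 0 ≤ √((n : ℝ) + 1) - √n := sub_nonneg.2 (Real.sqrt_le_sqrt (by linarith))
    have h5 : 1 / √((n : ℝ) + 1 / 2) ≤ 4 * (√((n : ℝ) + 1) - √n) := by
      rw [div_le_iff₀ hs]
      nlinarith
    push_cast
    linarith

/-- The sum is split at the centre `N + 1/2`; both halves run over distances `j + 1/2`. -/
theorem sum_inv_sqrt_abs_sub_le (N : ℕ) :
    ∑ k ∈ Finset.range (2 * N + 1), 1 / √|((k : ℝ) + 1) - (N + 1 / 2)| ≤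
      8 * √((2 * N + 1 : ℕ) : ℝ) := by
  rw [show 2 * N + 1 = N + (N + 1) by ring, Finset.sum_range_add, ← Finset.sum_range_reflect]
  have e1 : ∑ j ∈ Finset.range N, 1 / √|(((N - 1 - j : ℕ) : ℝ) + 1) - (N + 1 / 2)| =
      ∑ j ∈ Finset.range N, 1 / √((j : ℝ) + 1 / 2) := by
    refine Finset.sum_congr rfl fun j hj => ?_
    have hj' : j + 1 ≤ N := Finset.mem_range.1 hj
    rw [Nat.sub_sub, Nat.cast_sub (by omega), abs_of_neg (by push_cast; linarith)]
    push_cast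
    ring_nf
  have e2 : ∑ j ∈ Finset.range (N + 1), 1 / √|(((N + j : ℕ) : ℝ) + 1) - (N + 1 / 2)| =
      ∑ j ∈ Finset.range (N + 1), 1 / √((j : ℝ) + 1 / 2) := by
    refine Finset.sum_congr rfl fun j _ => ?_
    rw [abs_of_pos (by push_cast; linarith [(Nat.cast_nonneg j : (0 : ℝ) ≤ j)])]
    push_cast
    ring_nf
  rw [e1, e2]
  have h1 := (sum_inv_sqrt_le N).trans (mul_le_mul_of_nonneg_left (Real.sqrt_le_sqrt
    (by exact_mod_cast (by omega) : (N : ℝ) ≤ (N + (N + 1) : ℕ))) (by norm_num))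
  have h2 := (sum_inv_sqrt_le (N + 1)).trans (mul_le_mul_of_nonneg_left (Real.sqrt_le_sqrt
    (by exact_mod_cast (by omega) : ((N + 1 : ℕ) : ℝ) ≤ (N + (N + 1) : ℕ))) (by norm_num))
  linarith

/-- Near `m = R` the logarithm is traded for an inverse square root by `log y ≤ 2√y`. Summed over
`m` this costs only `O(R²)`, whereas bounding each logarithm by `O(log R)` would give `R² log R`,
the order of the main term. -/
theorem mul_abs_log_one_sub_div_le {R m : ℝ} (hR : 0 ≤ R) (hm : 0 < m) (hmR : m ≤ 2 * R)
    (h : m ≠ R) :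
    m * |Real.log (1 - R / m)| ≤ R + 2 * (2 * R) * √(2 * R) * (1 / √|m - R|) := by
  have hd : 0 < |m - R| := abs_pos.2 (sub_ne_zero.2 h)
  have e : |1 - R / m| = |m - R| / m := by
    rw [show 1 - R / m = (m - R) / m by field_simp, abs_div, abs_of_pos hm]
  have hlog : Real.log (1 - R / m) = Real.log (|m - R| / m) := by rw [← Real.log_abs, e]
  have hnn : 0 ≤ 2 * (2 * R) * √(2 * R) * (1 / √|m - R|) := by positivity
  rcases abs_cases (Real.log (1 - R / m)) with ⟨ha, _⟩ | ⟨ha, _⟩ <;> rw [ha, hlog]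
  · have h1 := Real.log_le_sub_one_of_pos (div_pos hd hm)
    have h2 : |m - R| ≤ m + R := by rw [abs_le]; constructor <;> linarith
    have h3 := mul_le_mul_of_nonneg_left h1 hm.le
    rw [mul_sub, mul_div_cancel₀ _ hm.ne'] at h3
    linarith
  · rw [← Real.log_inv, inv_div]
    have h1 := log_le_two_mul_sqrt (div_pos hm hd)
    rw [Real.sqrt_div hm.le] at h1
    have h2 : √m ≤ √(2 * R) := Real.sqrt_le_sqrt hmR
    calc m * Real.log (m / |m - R|) ≤ (2 * R) * (2 * (√(2 * R) / √|m - R|)) := by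
          refine (mul_le_mul_of_nonneg_left (h1.trans ?_) hm.le).trans
            (mul_le_mul_of_nonneg_right hmR (by positivity))
          gcongr
      _ = 2 * (2 * R) * √(2 * R) * (1 / √|m - R|) := by ring
      _ ≤ _ := by linarith

theorem sum_norm_mul_log_le {N : ℕ} {ζ : ℂ} (hζ : ‖ζ‖ = N + 1 / 2) :
    ∑ k ∈ Finset.range (2 * N + 1), ‖((k : ℂ) + 1) * Complex.log (1 + ζ / ((k + 1 : ℝ) : ℂ))‖ ≤
      82 * ‖ζ‖ ^ 2 := by
  set R := ‖ζ‖ with hRdef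
  have hR : 0 ≤ R := norm_nonneg _
  have hK : ((2 * N + 1 : ℕ) : ℝ) = 2 * R := by rw [hζ]; push_cast; ring
  have hterm : ∀ k ∈ Finset.range (2 * N + 1),
      ‖((k : ℂ) + 1) * Complex.log (1 + ζ / ((k + 1 : ℝ) : ℂ))‖ ≤
        (2 * R + 2 * R * Real.pi) +
          2 * (2 * R) * √(2 * R) * (1 / √|((k : ℝ) + 1) - (N + 1 / 2)|) := by
    intro k hk
    have hm : (0 : ℝ) < (k : ℝ) + 1 := by positivity
    have hmR : (k : ℝ) + 1 ≤ 2 * R := by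
      rw [← hK]
      exact_mod_cast Finset.mem_range.1 hk
    have hne : (k : ℝ) + 1 ≠ R := by
      rw [hζ]
      intro h
      have h' : 2 * (k + 1) = 2 * N + 1 := by
        have : (2 * (k + 1) : ℝ) = 2 * N + 1 := by linarith
        exact_mod_cast this
      omega
    have h1 := mul_le_mul_of_nonneg_left (norm_log_one_add_div_le (ζ := ζ) hm hne.symm) hm.le
    rw [← hRdef] at h1
    have h2 := mul_abs_log_one_sub_div_le hR hm hmR hne
    have h3 := mul_le_mul_of_nonneg_right hmR Real.pi_pos.le
    have hc : ‖(k : ℂ) + 1‖ = (k : ℝ) + 1 := by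
      rw [show ((k : ℂ) + 1) = (((k : ℝ) + 1 : ℝ) : ℂ) by push_cast; rfl, Complex.norm_real,
        Real.norm_of_nonneg hm.le]
    rw [norm_mul, hc, ← hζ]
    rw [mul_add, mul_add, mul_div_cancel₀ _ hm.ne'] at h1
    linarith
  refine (Finset.sum_le_sum hterm).trans ?_
  rw [Finset.sum_add_distrib, ← Finset.mul_sum, Finset.sum_const, Finset.card_range,
    nsmul_eq_mul, hK]
  have hs := sum_inv_sqrt_abs_sub_le N
  rw [hK] at hs
  have h4 := mul_le_mul_of_nonneg_left hs (by positivity : 0 ≤ 2 * (2 * R) * √(2 * R))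
  have h5 : 2 * (2 * R) * √(2 * R) * (8 * √(2 * R)) = 64 * R ^ 2 := by
    linear_combination 32 * R * Real.sq_sqrt (by positivity : 0 ≤ 2 * R)
  -- The total is `(4 + 4π + 64) R²`, below `82 R²`.
  nlinarith [Real.pi_lt_d2, sq_nonneg R]

theorem abs_harmonic_sub_log_le {R : ℝ} {K : ℕ} (hK0 : K ≠ 0) (hK : (K : ℝ) = 2 * R) :
    |(harmonic K : ℝ) - Real.log R| ≤ 2 := by
  have h1 := harmonic_le_one_add_log K
  have h2 := log_add_one_le_harmonic K
  have hK1 : (0 : ℝ) < K := by positivity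
  have hR : 0 < R := by linarith
  have h3 := Real.log_le_log hK1 (by push_cast; linarith : (K : ℝ) ≤ ((K + 1 : ℕ) : ℝ))
  rw [hK, Real.log_mul two_ne_zero hR.ne'] at h1 h3
  have h4 := Real.log_two_lt_d9
  have h5 := Real.log_two_gt_d9
  rw [abs_le]
  constructor <;> push_cast at * <;> linarith

/-- The leading term of `log G (1 + ζ)`, uniformly on the circles `‖ζ‖ = N + 1 / 2`. -/
theorem exists_norm_logBarnesG_sub_le :
    ∃ C : ℝ, 0 ≤ C ∧ ∀ (N : ℕ) (ζ : ℂ), ‖ζ‖ = N + 1 / 2 →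
      ‖logBarnesG (1 + ζ) - ζ ^ 2 / 2 * Complex.log ζ‖ ≤ C * ‖ζ‖ ^ 2 := by
  refine ⟨Real.log (2 * Real.pi) + |1 + Real.eulerMascheroniConstant| / 2 + 1 + 82 + 2 + 3 + 1,
    by have := one_lt_log_two_pi; positivity, fun N ζ hζ => ?_⟩
  set R := ‖ζ‖ with hRdef
  have hR : 1 / 2 ≤ R := by rw [hζ]; linarith [(Nat.cast_nonneg N : (0 : ℝ) ≤ N)]
  -- Cutting the series at `2N + 1 = 2R` makes the tail `O(R²)` and turns the harmonic number into
  -- `log R + O(1)`, the source of the main term `(ζ²/2) log ζ`.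
  have hK : ((2 * N + 1 : ℕ) : ℝ) = 2 * R := by rw [hζ]; push_cast; ring
  have hR2 : R ≤ 2 * R ^ 2 := by nlinarith
  have h1 : ‖ζ / 2 * (Real.log (2 * Real.pi) : ℂ)‖ ≤ Real.log (2 * Real.pi) * R ^ 2 := by
    rw [norm_mul, norm_div, Complex.norm_real, Complex.norm_two,
      Real.norm_of_nonneg (by linarith [one_lt_log_two_pi])]
    nlinarith [one_lt_log_two_pi]
  have h2 : ‖((1 + (Real.eulerMascheroniConstant : ℂ)) * ζ ^ 2 + ζ) / 2‖ ≤
      (|1 + Real.eulerMascheroniConstant| / 2 + 1) * R ^ 2 := by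
    rw [norm_div, Complex.norm_two]
    have := norm_add_le ((1 + (Real.eulerMascheroniConstant : ℂ)) * ζ ^ 2) ζ
    rw [norm_mul, norm_pow, ← Complex.ofReal_one, ← Complex.ofReal_add, Complex.norm_real,
      Real.norm_eq_abs] at this
    push_cast at this
    nlinarith
  have h3 := (norm_sum_le _ _).trans (sum_norm_mul_log_le hζ)
  have h4 : ‖((2 * N + 1 : ℕ) : ℂ) * ζ‖ ≤ 2 * R ^ 2 := by
    rw [norm_mul, Complex.norm_natCast, hK]
    nlinarith
  have h5 : ‖ζ ^ 2 / 2 * (((harmonic (2 * N + 1) : ℝ) : ℂ) - Complex.log ζ)‖ ≤ 3 * R ^ 2 := by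
    rw [norm_mul, norm_div, norm_pow, Complex.norm_two]
    have e : ((harmonic (2 * N + 1) : ℝ) : ℂ) - Complex.log ζ =
        (((harmonic (2 * N + 1) : ℝ) - Real.log R : ℝ) : ℂ) + ((-ζ.arg : ℝ) : ℂ) * Complex.I := by
      rw [Complex.log]
      push_cast
      ring
    have : ‖((harmonic (2 * N + 1) : ℝ) : ℂ) - Complex.log ζ‖ ≤ 2 + Real.pi := by
      rw [e]
      refine (norm_add_le _ _).trans (add_le_add ?_ ?_)
      · rw [Complex.norm_real]
        exact abs_harmonic_sub_log_le (by omega) hK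
      · rw [norm_mul, Complex.norm_I, mul_one, Complex.norm_real, norm_neg]
        exact Complex.abs_arg_le_pi ζ
    nlinarith [Real.pi_lt_d2, sq_nonneg R]
  have h6 : ‖∑' k : ℕ, logBarnesGTerm (k + (2 * N + 1)) (1 + ζ)‖ ≤ R ^ 2 := by
    refine (norm_tsum_logBarnesGTerm_add_le le_rfl hK.ge (by omega)).trans ?_
    rw [hK, ← hRdef, div_le_iff₀ (by linarith)]
    nlinarith [pow_pos (by linarith : 0 < R) 3]
  rw [logBarnesG_one_add (2 * N + 1)]
  calc _ = ‖ζ / 2 * (Real.log (2 * Real.pi) : ℂ) -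
          ((1 + (Real.eulerMascheroniConstant : ℂ)) * ζ ^ 2 + ζ) / 2 +
        (∑ k ∈ Finset.range (2 * N + 1),
            ((k : ℂ) + 1) * Complex.log (1 + ζ / ((k + 1 : ℝ) : ℂ)) -
          ((2 * N + 1 : ℕ) : ℂ) * ζ) +
        ζ ^ 2 / 2 * (((harmonic (2 * N + 1) : ℝ) : ℂ) - Complex.log ζ) +
        ∑' k : ℕ, logBarnesGTerm (k + (2 * N + 1)) (1 + ζ)‖ := by
        congr 1
        ring
    _ ≤ _ := norm_add₄_le
    _ ≤ _ := add_le_add (add_le_add (add_le_add (norm_sub_le _ _) (norm_sub_le _ _)) le_rfl) le_rfl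
    _ ≤ _ := by linarith

/-- A bound for `log G (1 + ζ)` that only depends on `‖ζ‖`. -/
theorem exists_norm_logBarnesG_le (R : ℝ) (hR : 0 < R) :
    ∃ (C : ℝ) (K : ℕ), 0 ≤ C ∧ ∀ ζ : ℂ, ‖ζ‖ ≤ R → (∀ k : ℕ, ‖ζ‖ ≠ k) →
      ‖logBarnesG (1 + ζ)‖ ≤
        C + ∑ k ∈ Finset.range K, ((k : ℝ) + 1) * |Real.log (1 - ‖ζ‖ / ((k : ℝ) + 1))| := by
  obtain ⟨K, hK⟩ := exists_nat_ge (2 * R)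
  have hK0 : 0 < K := by
    have : (0 : ℝ) < K := by linarith
    exact_mod_cast this
  set c1 := ‖(Real.log (2 * Real.pi) : ℂ)‖
  set c2 := ‖1 + (Real.eulerMascheroniConstant : ℂ)‖
  have hh : (0 : ℝ) ≤ harmonic K := by
    have : (0 : ℚ) ≤ harmonic K := (harmonic_pos hK0.ne').le
    exact_mod_cast this
  refine ⟨R / 2 * c1 + (c2 * R ^ 2 + R) / 2 +
    ∑ k ∈ Finset.range K, (R + ((k : ℝ) + 1) * Real.pi) + K * R + R ^ 2 / 2 * (harmonic K : ℝ) +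
    R ^ 3 / K, K, by have := Real.pi_pos; positivity, fun ζ hζ hne => ?_⟩
  have h1 : ‖ζ / 2 * (Real.log (2 * Real.pi) : ℂ)‖ ≤ R / 2 * c1 := by
    rw [norm_mul, norm_div, Complex.norm_two]
    gcongr
  have h2 : ‖((1 + (Real.eulerMascheroniConstant : ℂ)) * ζ ^ 2 + ζ) / 2‖ ≤
      (c2 * R ^ 2 + R) / 2 := by
    rw [norm_div, Complex.norm_two]
    gcongr
    refine (norm_add_le _ _).trans ?_
    rw [norm_mul, norm_pow]
    gcongr
  have h3 : ‖∑ k ∈ Finset.range K, ((k : ℂ) + 1) * Complex.log (1 + ζ / ((k + 1 : ℝ) : ℂ))‖ ≤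
      ∑ k ∈ Finset.range K, (R + ((k : ℝ) + 1) * Real.pi) +
        ∑ k ∈ Finset.range K, ((k : ℝ) + 1) * |Real.log (1 - ‖ζ‖ / ((k : ℝ) + 1))| := by
    refine (norm_sum_le _ _).trans ?_
    rw [← Finset.sum_add_distrib]
    refine Finset.sum_le_sum fun k _ => ?_
    have hm : (0 : ℝ) < (k : ℝ) + 1 := by positivity
    have h := mul_le_mul_of_nonneg_left (norm_log_one_add_div_le (ζ := ζ) hm
      (by exact_mod_cast hne (k + 1))) hm.le
    have hc : ‖(k : ℂ) + 1‖ = (k : ℝ) + 1 := by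
      rw [show ((k : ℂ) + 1) = (((k : ℝ) + 1 : ℝ) : ℂ) by push_cast; rfl, Complex.norm_real,
        Real.norm_of_nonneg hm.le]
    rw [norm_mul, hc]
    rw [mul_add, mul_add, mul_div_cancel₀ _ hm.ne'] at h
    linarith
  have h4 : ‖(K : ℂ) * ζ‖ ≤ K * R := by
    rw [norm_mul, Complex.norm_natCast]
    gcongr
  have h5 : ‖ζ ^ 2 / 2 * ((harmonic K : ℝ) : ℂ)‖ ≤ R ^ 2 / 2 * (harmonic K : ℝ) := by
    rw [norm_mul, norm_div, norm_pow, Complex.norm_two, Complex.norm_real, Real.norm_of_nonneg hh]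
    gcongr
  have h6 := norm_tsum_logBarnesGTerm_add_le hζ hK hK0
  rw [logBarnesG_one_add K]
  calc _ ≤ _ := norm_add₃_le
    _ ≤ _ := add_le_add (add_le_add (norm_sub_le _ _) ((norm_add_le _ _).trans
      (add_le_add (norm_sub_le _ _) le_rfl))) le_rfl
    _ ≤ _ := by linarith

/-! ### The logarithmic coordinate and Cauchy's theorem in the strip. -/

/-- The quotient `log G (1 + z) / (z ^ 2 * log z)` in the variable `u = log z`. -/
noncomputable def stripQuotient (u : ℂ) : ℂ :=
  logBarnesG (1 + Complex.exp u) / (Complex.exp (2 * u) * u)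

/-- The Cauchy kernel `dz / (z - c)` in the variable `u = log z`. -/
noncomputable def stripKernel (c u : ℂ) : ℂ := Complex.exp u / (Complex.exp u - c)

theorem one_add_mem_slitPlane {z : ℂ} (hz : z ∈ Complex.slitPlane) :
    1 + z ∈ Complex.slitPlane := by
  rw [Complex.mem_slitPlane_iff] at hz ⊢
  rcases hz with h | h
  · left
    simp
    linarith
  · right
    simpa using h

theorem exp_mem_slitPlane {u : ℂ} (hu : |u.im| < Real.pi) : Complex.exp u ∈ Complex.slitPlane := by
  rw [abs_lt] at hu
  rw [Complex.mem_slitPlane_iff_arg, ← Complex.log_im, Complex.log_exp hu.1 hu.2.le]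
  exact ⟨hu.2.ne, Complex.exp_ne_zero u⟩

theorem exp_eq_iff_of_abs_im_lt {u v : ℂ} (hu : |u.im| < Real.pi) (hv : |v.im| < Real.pi) :
    Complex.exp u = Complex.exp v ↔ u = v := by
  rw [abs_lt] at hu hv
  refine ⟨fun h => ?_, fun h => h ▸ rfl⟩
  rw [← Complex.log_exp hu.1 hu.2.le, h, Complex.log_exp hv.1 hv.2.le]

theorem barnesQuotient_exp {u : ℂ} (h1 : -Real.pi < u.im) (h2 : u.im ≤ Real.pi) :
    barnesQuotient (Complex.exp u) = stripQuotient u := by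
  rw [barnesQuotient, stripQuotient, Complex.log_exp h1 h2, ← Complex.exp_nat_mul, add_comm]
  norm_num

theorem stripQuotient_conj {u : ℂ} (hu : |u.im| < Real.pi) :
    stripQuotient (starRingEnd ℂ u) = starRingEnd ℂ (stripQuotient u) := by
  rw [stripQuotient, stripQuotient, map_div₀,
    ← conj_logBarnesG (one_add_mem_slitPlane (exp_mem_slitPlane hu))]
  simp [← Complex.exp_conj, map_ofNat]

theorem isOpen_strip : IsOpen {u : ℂ | |u.im| < Real.pi} :=
  isOpen_lt (by fun_prop) continuous_const

theorem dslope_exp_ne_zero {u v : ℂ} (hu : |u.im| < Real.pi) (hv : |v.im| < Real.pi) :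
    dslope Complex.exp v u ≠ 0 := by
  rcases eq_or_ne u v with rfl | h
  · rw [dslope_same, Complex.deriv_exp]
    exact Complex.exp_ne_zero u
  · rw [dslope_of_ne _ h, slope_def_field]
    exact div_ne_zero (sub_ne_zero.2 fun e => h ((exp_eq_iff_of_abs_im_lt hu hv).1 e))
      (sub_ne_zero.2 h)

/-- The holomorphic function on the strip which extends
`(stripQuotient u - stripQuotient v) * stripKernel (exp v) u`. -/
noncomputable def stripHolo (v u : ℂ) : ℂ :=
  dslope (dslope (fun u => logBarnesG (1 + Complex.exp u) / Complex.exp (2 * u)) 0) v u /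
    dslope Complex.exp v u * Complex.exp u

/-- `dslope` preserves holomorphy, which removes the singularities at `u = 0` and `u = v`; the
denominator has no zeros since `exp` is injective on the strip. -/
theorem differentiableOn_stripHolo {v : ℂ} (hv : |v.im| < Real.pi) :
    DifferentiableOn ℂ (stripHolo v) {u : ℂ | |u.im| < Real.pi} := by
  have h0 : {u : ℂ | |u.im| < Real.pi} ∈ nhds (0 : ℂ) :=
    isOpen_strip.mem_nhds (by simp [Real.pi_pos])
  have h1 : {u : ℂ | |u.im| < Real.pi} ∈ nhds v := isOpen_strip.mem_nhds hv
  have hP : DifferentiableOn ℂ (fun u => logBarnesG (1 + Complex.exp u) / Complex.exp (2 * u))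
      {u : ℂ | |u.im| < Real.pi} := by
    refine DifferentiableOn.div ?_ (by fun_prop) fun u _ => Complex.exp_ne_zero _
    exact differentiableOn_logBarnesG.comp (by fun_prop) fun u hu =>
      one_add_mem_slitPlane (exp_mem_slitPlane hu)
  refine DifferentiableOn.mul (DifferentiableOn.div ?_ ?_ fun u hu => dslope_exp_ne_zero hu hv)
    (by fun_prop)
  · exact (Complex.differentiableOn_dslope h1).2 ((Complex.differentiableOn_dslope h0).2 hP)
  · exact (Complex.differentiableOn_dslope h1).2 (by fun_prop)

theorem logBarnesG_two : logBarnesG 2 = 0 := by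
  have h := re_logBarnesG_one_add (z := 1) fun k => by positivity
  have hi := logBarnesG_ofReal_im (x := 2) two_pos
  rw [Complex.ofReal_one, logBarnesG_one, Real.Gamma_one, Real.log_one, one_add_one_eq_two] at h
  exact Complex.ext (by simpa using h) (by simpa using hi)

theorem stripHolo_eq {u v : ℂ} (hu : u ≠ 0) (hv : v ≠ 0) (huv : u ≠ v) :
    stripHolo v u = (stripQuotient u - stripQuotient v) * stripKernel (Complex.exp v) u := by
  have hd {w : ℂ} (hw : w ≠ 0) :
      dslope (fun u => logBarnesG (1 + Complex.exp u) / Complex.exp (2 * u)) 0 w =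
        stripQuotient w := by
    rw [dslope_of_ne _ hw, slope_def_field, stripQuotient]
    simp [one_add_one_eq_two, logBarnesG_two, div_div]
  rw [stripHolo, dslope_of_ne _ huv, dslope_of_ne _ huv, slope_def_field, slope_def_field,
    hd hu, hd hv, stripKernel, div_div_div_cancel_right₀ (sub_ne_zero.2 huv)]
  ring

/-- Cauchy's theorem on a rectangle inside the strip. -/
theorem strip_rect_identity {a b θ : ℝ} {v : ℂ} (hv : v ≠ 0) (ha : a < v.re) (hb : v.re < b)
    (ha0 : a < 0) (hb0 : 0 < b) (hθ : |v.im| < θ) (hθπ : θ < Real.pi) :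
    let H := fun u => (stripQuotient u - stripQuotient v) * stripKernel (Complex.exp v) u
    (∫ x : ℝ in a..b, (H (x - θ * Complex.I) - H (x + θ * Complex.I))) +
      Complex.I * (∫ y : ℝ in -θ..θ, H (b + y * Complex.I)) -
      Complex.I * (∫ y : ℝ in -θ..θ, H (a + y * Complex.I)) = 0 := by
  intro H
  have hθ0 : 0 < θ := (abs_nonneg _).trans_lt hθ
  have hvπ : |v.im| < Real.pi := hθ.trans hθπ
  have hab : a ≤ b := (ha.trans hb).le
  have hsub : Set.uIcc a b ×ℂ Set.uIcc (-θ) θ ⊆ {u : ℂ | |u.im| < Real.pi} := by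
    intro u hu
    rw [Complex.mem_reProdIm, Set.uIcc_of_le (by linarith : -θ ≤ θ)] at hu
    exact (abs_le.2 hu.2).trans_lt hθπ
  have hdiff := (differentiableOn_stripHolo hvπ).mono hsub
  have key := Complex.integral_boundary_rect_eq_zero_of_differentiableOn (stripHolo v)
    ⟨a, -θ⟩ ⟨b, θ⟩ hdiff
  simp only [smul_eq_mul] at key
  have hhor (x s : ℝ) (hs : |s| = θ) : stripHolo v (x + s * Complex.I) = H (x + s * Complex.I) := by
    refine stripHolo_eq ?_ hv ?_
    · intro h
      have := congrArg Complex.im h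
      simp at this
      rw [this, abs_zero] at hs
      exact hθ0.ne hs
    · rintro rfl
      simp [hs] at hθ
  have hver (x : ℝ) (hx0 : x ≠ 0) (hx : x ≠ v.re) (y : ℝ) :
      stripHolo v (x + y * Complex.I) = H (x + y * Complex.I) := by
    refine stripHolo_eq ?_ hv ?_
    · intro h
      exact hx0 (by simpa using congrArg Complex.re h)
    · rintro rfl
      simp at hx
  have hint (s : ℝ) (hs : |s| = θ) :
      IntervalIntegrable (fun x : ℝ => stripHolo v (x + s * Complex.I)) MeasureTheory.volume a b := by
    refine ContinuousOn.intervalIntegrable (hdiff.continuousOn.comp (by fun_prop) fun x hx => ?_)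
    rw [Complex.mem_reProdIm]
    refine ⟨by simpa using hx, ?_⟩
    rw [Set.uIcc_of_le (by linarith : -θ ≤ θ)]
    simpa using abs_le.1 hs.le
  have h1 : |-θ| = θ := by rw [abs_neg, abs_of_pos hθ0]
  have h2 : |θ| = θ := abs_of_pos hθ0
  have e1 := intervalIntegral.integral_sub (hint _ h1) (hint _ h2)
  rw [← e1] at key
  simp only [hhor _ _ h1, hhor _ _ h2, hver b hb0.ne' hb.ne', hver a ha0.ne ha.ne] at key
  rw [← key]
  simp [sub_eq_add_neg]

/-! ### Vertical edges: integrability and the integral of the kernel. -/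

theorem measurable_stripQuotient : Measurable stripQuotient :=
  (measurable_logBarnesG.comp (by fun_prop)).div (by fun_prop)

theorem measurable_stripKernel (c : ℂ) : Measurable (stripKernel c) :=
  Measurable.div (by fun_prop) (by fun_prop)

theorem norm_stripKernel_vertical_le {c : ℂ} {x : ℝ} (h : Real.exp x ≠ ‖c‖) (y : ℝ) :
    ‖stripKernel c (x + y * Complex.I)‖ ≤ Real.exp x / |Real.exp x - ‖c‖| := by
  have hn : ‖Complex.exp (x + y * Complex.I)‖ = Real.exp x := by simp [Complex.norm_exp]
  rw [stripKernel, norm_div, hn]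
  have := abs_norm_sub_norm_le (Complex.exp (x + y * Complex.I)) c
  rw [hn] at this
  have h0 : 0 < |Real.exp x - ‖c‖| := abs_pos.2 (sub_ne_zero.2 h)
  gcongr

theorem norm_stripQuotient_le {u : ℂ} {A : ℝ} (hu : u ≠ 0)
    (hA : ‖logBarnesG (1 + Complex.exp u)‖ ≤ A) :
    ‖stripQuotient u‖ ≤ A / (Real.exp (2 * u.re) * ‖u‖) := by
  have h0 : 0 < ‖u‖ := norm_pos_iff.2 hu
  rw [stripQuotient, norm_div, norm_mul, Complex.norm_exp]
  have : (2 * u).re = 2 * u.re := by simp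
  rw [this]
  gcongr

theorem intervalIntegrable_of_measurable_of_norm_le {f : ℝ → ℂ} (hf : Measurable f) {B : ℝ}
    (hB : ∀ y, ‖f y‖ ≤ B) (a b : ℝ) : IntervalIntegrable f MeasureTheory.volume a b :=
  (intervalIntegrable_const (c := B)).mono_fun' hf.aestronglyMeasurable
    (Filter.Eventually.of_forall hB)

theorem exists_norm_stripQuotient_vertical_le {x : ℝ} (hx0 : x ≠ 0)
    (hnat : ∀ k : ℕ, Real.exp x ≠ k) :
    ∃ B : ℝ, ∀ y : ℝ, ‖stripQuotient (x + y * Complex.I)‖ ≤ B := by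
  obtain ⟨C, K, hC, h⟩ := exists_norm_logBarnesG_le (Real.exp x) (Real.exp_pos x)
  have hn (y : ℝ) : ‖Complex.exp (x + y * Complex.I)‖ = Real.exp x := by simp [Complex.norm_exp]
  refine ⟨(C + ∑ k ∈ Finset.range K, ((k : ℝ) + 1) * |Real.log (1 - Real.exp x / ((k : ℝ) + 1))|) /
    (Real.exp (2 * x) * |x|), fun y => ?_⟩
  have hy := h (Complex.exp (x + y * Complex.I)) (hn y).le (by simpa only [hn] using hnat)
  rw [hn] at hy
  have hre : (x + y * Complex.I : ℂ).re = x := by simp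
  have hle : |x| ≤ ‖(x + y * Complex.I : ℂ)‖ := by
    simpa using Complex.abs_re_le_norm (x + y * Complex.I : ℂ)
  have hx : 0 < |x| := abs_pos.2 hx0
  refine (norm_stripQuotient_le (norm_pos_iff.1 (hx.trans_le hle)) hy).trans ?_
  rw [hre]
  gcongr

theorem intervalIntegrable_stripKernel_vertical {c : ℂ} {x : ℝ} (hx : Real.exp x ≠ ‖c‖)
    (a b : ℝ) :
    IntervalIntegrable (fun y : ℝ => stripKernel c (x + y * Complex.I)) MeasureTheory.volume a b :=
  intervalIntegrable_of_measurable_of_norm_le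
    ((measurable_stripKernel c).comp (by fun_prop)) (norm_stripKernel_vertical_le hx) a b

theorem intervalIntegrable_stripQuotient_mul_vertical {c : ℂ} {x : ℝ} (hx0 : x ≠ 0)
    (hx : Real.exp x ≠ ‖c‖) (hnat : ∀ k : ℕ, Real.exp x ≠ k) (a b : ℝ) :
    IntervalIntegrable (fun y : ℝ => stripQuotient (x + y * Complex.I) *
      stripKernel c (x + y * Complex.I)) MeasureTheory.volume a b := by
  obtain ⟨B, hB⟩ := exists_norm_stripQuotient_vertical_le hx0 hnat
  refine intervalIntegrable_of_measurable_of_norm_le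
    ((measurable_stripQuotient.comp (by fun_prop)).mul
      ((measurable_stripKernel c).comp (by fun_prop)))
    (B := B * (Real.exp x / |Real.exp x - ‖c‖|)) (fun y => ?_) a b
  rw [Pi.mul_apply, norm_mul]
  exact mul_le_mul (hB y) (norm_stripKernel_vertical_le hx y) (norm_nonneg _)
    ((norm_nonneg _).trans (hB y))

theorem tendsto_integral_symm {f : ℝ → ℂ} (T : ℝ)
    (hf : ∀ a b, IntervalIntegrable f MeasureTheory.volume a b) :
    Filter.Tendsto (fun θ : ℝ => ∫ y in -θ..θ, f y) (nhdsWithin T (Set.Iio T))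
      (nhds (∫ y in -T..T, f y)) := by
  have hc : Continuous fun θ : ℝ => ∫ y in (0 : ℝ)..θ, f y :=
    intervalIntegral.continuous_primitive hf 0
  have e : (fun θ : ℝ => ∫ y in -θ..θ, f y) =
      fun θ => (∫ y in (0 : ℝ)..θ, f y) - ∫ y in (0 : ℝ)..(-θ), f y := by
    ext θ
    rw [intervalIntegral.integral_interval_sub_left (hf _ _) (hf _ _)]
  have hc2 : Continuous fun θ : ℝ => ∫ y in -θ..θ, f y := by
    rw [e]
    exact hc.sub (hc.comp continuous_neg)
  exact hc2.continuousWithinAt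

theorem I_mul_integral_stripKernel (c : ℂ) (x : ℝ) :
    Complex.I * ∫ y in -Real.pi..Real.pi, stripKernel c (x + y * Complex.I) =
      ∮ z in C(0, Real.exp x), (z - c)⁻¹ := by
  have hper : Function.Periodic (fun y : ℝ => stripKernel c (x + y * Complex.I))
      (2 * Real.pi) := by
    intro y
    have : (x : ℂ) + (y + 2 * Real.pi : ℝ) * Complex.I =
        x + y * Complex.I + 2 * Real.pi * Complex.I := by push_cast; ring
    simp only [stripKernel, this, Complex.exp_periodic _]
  have h := hper.intervalIntegral_add_eq (-Real.pi) 0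
  rw [show -Real.pi + 2 * Real.pi = Real.pi by ring, zero_add] at h
  rw [h, circleIntegral, ← intervalIntegral.integral_const_mul]
  refine intervalIntegral.integral_congr fun y _ => ?_
  simp only [stripKernel, deriv_circleMap, circleMap_zero, Complex.exp_add, Complex.ofReal_exp,
    smul_eq_mul]
  ring

theorem I_mul_integral_stripKernel_of_lt {c : ℂ} {x : ℝ} (h : ‖c‖ < Real.exp x) :
    Complex.I * ∫ y in -Real.pi..Real.pi, stripKernel c (x + y * Complex.I) =
      2 * Real.pi * Complex.I := by
  rw [I_mul_integral_stripKernel, circleIntegral.integral_sub_inv_of_mem_ball (by simpa using h)]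

theorem I_mul_integral_stripKernel_of_gt {c : ℂ} {x : ℝ} (h : Real.exp x < ‖c‖) :
    Complex.I * ∫ y in -Real.pi..Real.pi, stripKernel c (x + y * Complex.I) = 0 := by
  rw [I_mul_integral_stripKernel]
  have hd : DifferentiableOn ℂ (fun z : ℂ => (z - c)⁻¹) (Metric.closedBall 0 (Real.exp x)) := by
    refine DifferentiableOn.inv (by fun_prop) fun z hz => sub_ne_zero.2 ?_
    rintro rfl
    simp at hz
    linarith
  refine Complex.circleIntegral_eq_zero_of_differentiable_on_off_countable (Real.exp_pos x).le
    Set.countable_empty hd.continuousOn fun z hz => ?_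
  exact (hd.mono Metric.ball_subset_closedBall).differentiableAt
    (Metric.isOpen_ball.mem_nhds hz.1)

/-! ### Horizontal edges: passage to the cut. -/

theorem exists_norm_stripKernel_horizontal_le {c : ℂ} {θ₀ : ℝ} (h0 : 0 < θ₀)
    (h : |c.arg| < θ₀) (a b : ℝ) :
    ∃ B : ℝ, ∀ x ∈ Set.Icc a b, ∀ θ ∈ Set.Icc θ₀ Real.pi,
      ‖stripKernel c (x + θ * Complex.I)‖ ≤ B := by
  have hcont : ContinuousOn (fun p : ℝ × ℝ => stripKernel c (p.1 + p.2 * Complex.I))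
      (Set.Icc a b ×ˢ Set.Icc θ₀ Real.pi) := by
    refine ContinuousOn.div (by fun_prop) (by fun_prop) fun p hp => sub_ne_zero.2 fun e => ?_
    have him : (p.1 + p.2 * Complex.I : ℂ).im = p.2 := by simp
    have h2 := hp.2
    have := congrArg Complex.im (Complex.log_exp (x := p.1 + p.2 * Complex.I)
      (by rw [him]; linarith [h2.1, Real.pi_pos]) (by rw [him]; exact h2.2))
    rw [e, Complex.log_im, him] at this
    linarith [le_abs_self c.arg, h2.1]
  obtain ⟨B, hB⟩ := (isCompact_Icc.prod isCompact_Icc).exists_bound_of_continuousOn hcont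
  exact ⟨B, fun x hx θ hθ => hB (x, θ) ⟨hx, hθ⟩⟩

theorem stripKernel_conj (c u : ℂ) :
    stripKernel c (starRingEnd ℂ u) = starRingEnd ℂ (stripKernel (starRingEnd ℂ c) u) := by
  simp [stripKernel, ← Complex.exp_conj]

theorem conj_add_mul_I (x θ : ℝ) :
    starRingEnd ℂ (x + θ * Complex.I) = x - θ * Complex.I := by
  simp [sub_eq_add_neg]

theorem exp_add_pi_mul_I (x : ℝ) :
    Complex.exp (x + Real.pi * Complex.I) = -(Real.exp x : ℂ) := by
  rw [Complex.exp_add, Complex.exp_pi_mul_I, Complex.ofReal_exp]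
  ring

theorem stripKernel_add_pi_mul_I (c : ℂ) (x : ℝ) :
    stripKernel c (x + Real.pi * Complex.I) = Real.exp x / (Real.exp x + c) := by
  rw [stripKernel, exp_add_pi_mul_I, ← neg_add', neg_div_neg_eq]

theorem tendsto_stripQuotient {x : ℝ} (hx : ∀ k : ℕ, Real.exp x ≠ k) :
    Filter.Tendsto (fun θ : ℝ => stripQuotient (x + θ * Complex.I))
      (nhdsWithin Real.pi (Set.Iio Real.pi)) (nhds (stripQuotient (x + Real.pi * Complex.I))) := by
  have hmem : 1 + Complex.exp (x + Real.pi * Complex.I) ∈ closedUpperMinusPoles := by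
    rw [exp_add_pi_mul_I]
    refine ⟨by simp, fun k h => hx (k + 1) ?_⟩
    have : (((k + 1 : ℕ) : ℝ) : ℂ) - (Real.exp x : ℂ) = 0 := by
      rw [← h]
      push_cast
      ring
    exact_mod_cast (sub_eq_zero.1 this).symm
  have hL : Filter.Tendsto (fun θ : ℝ => logBarnesG (1 + Complex.exp (x + θ * Complex.I)))
      (nhdsWithin Real.pi (Set.Iio Real.pi))
      (nhds (logBarnesG (1 + Complex.exp (x + Real.pi * Complex.I)))) := by
    refine (continuousOn_logBarnesG _ hmem).tendsto.comp
      (tendsto_nhdsWithin_iff.2 ⟨?_, ?_⟩)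
    · exact (by fun_prop : Continuous fun θ : ℝ =>
        1 + Complex.exp (x + θ * Complex.I)).continuousAt.continuousWithinAt
    · filter_upwards [Ioo_mem_nhdsLT Real.pi_pos] with θ hθ
      have him : 0 < (1 + Complex.exp (x + θ * Complex.I)).im := by
        simp [Complex.exp_im, Real.exp_pos, Real.sin_pos_of_pos_of_lt_pi hθ.1 hθ.2]
      refine ⟨him.le, fun k h => ?_⟩
      have := congrArg Complex.im h
      simp at this him
      linarith
  refine hL.div (Filter.Tendsto.mono_left (Continuous.tendsto (by fun_prop) _)
    nhdsWithin_le_nhds) (mul_ne_zero (Complex.exp_ne_zero _) fun h => ?_)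
  simpa using congrArg Complex.im h

theorem ae_exp_ne_natCast : ∀ᵐ x : ℝ, ∀ k : ℕ, Real.exp x ≠ k := by
  have hc : (Real.exp ⁻¹' Set.range ((↑) : ℕ → ℝ)).Countable :=
    (Set.countable_range _).preimage_of_injOn Real.exp_injective.injOn
  filter_upwards [hc.ae_notMem MeasureTheory.volume] with x hx k hk
  exact hx ⟨k, hk.symm⟩

theorem intervalIntegrable_log_one_sub_exp_div (m a b : ℝ) :
    IntervalIntegrable (fun x : ℝ => |Real.log (1 - Real.exp x / m)|) MeasureTheory.volume a b := by
  have h : AnalyticOnNhd ℝ (fun x : ℝ => 1 - Real.exp x / m) (Set.uIcc a b) := fun x _ => by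
    fun_prop
  exact h.meromorphicOn.intervalIntegrable_log.abs

/-- One majorant serves all heights `θ`: the bound on `log G` depends on `|exp u| = exp x` only,
with integrable logarithmic singularities, and `|u| ≥ θ₀`. -/
theorem exists_bound_stripQuotient_horizontal {a b θ₀ : ℝ} (h0 : 0 < θ₀) :
    ∃ g : ℝ → ℝ, IntervalIntegrable g MeasureTheory.volume a b ∧
      ∀ x ∈ Set.Icc a b, (∀ k : ℕ, Real.exp x ≠ k) → ∀ θ ∈ Set.Icc θ₀ Real.pi,
        ‖stripQuotient (x + θ * Complex.I)‖ ≤ g x := by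
  obtain ⟨C, K, hC, h⟩ := exists_norm_logBarnesG_le (Real.exp b) (Real.exp_pos b)
  refine ⟨fun x => (C + ∑ k ∈ Finset.range K, ((k : ℝ) + 1) *
    |Real.log (1 - Real.exp x / ((k : ℝ) + 1))|) / (Real.exp (2 * a) * θ₀), ?_, ?_⟩
  · refine (intervalIntegrable_const.add ?_).div_const _
    simpa only [Finset.sum_fn] using IntervalIntegrable.sum (Finset.range K) fun k _ =>
      (intervalIntegrable_log_one_sub_exp_div ((k : ℝ) + 1) a b).const_mul ((k : ℝ) + 1)
  · intro x hx hnat θ hθ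
    have hn : ‖Complex.exp (x + θ * Complex.I)‖ = Real.exp x := by simp [Complex.norm_exp]
    have hy := h (Complex.exp (x + θ * Complex.I)) (by rw [hn]; exact Real.exp_le_exp.2 hx.2)
      (by simpa only [hn] using hnat)
    rw [hn] at hy
    have hle : θ₀ ≤ ‖(x + θ * Complex.I : ℂ)‖ := by
      refine (hθ.1.trans (le_abs_self θ)).trans ?_
      simpa using Complex.abs_im_le_norm (x + θ * Complex.I : ℂ)
    refine (norm_stripQuotient_le (norm_pos_iff.1 (h0.trans_le hle)) hy).trans ?_
    have hre : (x + θ * Complex.I : ℂ).re = x := by simp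
    rw [hre]
    have hxa := hx.1
    have hnum := (norm_nonneg _).trans hy
    beta_reduce
    gcongr

theorem abs_arg_lt_pi {c : ℂ} (hc : c ∈ Complex.slitPlane) : |c.arg| < Real.pi :=
  abs_lt.2 ⟨Complex.neg_pi_lt_arg c,
    lt_of_le_of_ne (Complex.arg_le_pi c) (Complex.slitPlane_arg_ne_pi hc)⟩

/-- The two edges carry conjugate values of `stripQuotient`, while the kernel has the same limit on
both. So `q` cancels and only the imaginary part survives. -/
theorem tendsto_horizontal {c : ℂ} (hc : c ∈ Complex.slitPlane) (q : ℂ) {a b : ℝ} (hab : a ≤ b) :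
    let H := fun u => (stripQuotient u - q) * stripKernel c u
    Filter.Tendsto
      (fun θ : ℝ => ∫ x : ℝ in a..b, (H (x - θ * Complex.I) - H (x + θ * Complex.I)))
      (nhdsWithin Real.pi (Set.Iio Real.pi))
      (nhds (∫ x : ℝ in a..b, -(2 * Complex.I * (stripQuotient (x + Real.pi * Complex.I)).im) *
        (Real.exp x / (Real.exp x + c)))) := by
  intro H
  have harg : |c.arg| < Real.pi := abs_arg_lt_pi hc
  -- A height strictly between the pole `log c` and the edge of the strip.
  set θ₀ := (|c.arg| + Real.pi) / 2 with hθ₀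
  have h0 : 0 < θ₀ := by have := Real.pi_pos; positivity
  have hθπ : θ₀ < Real.pi := by linarith
  have hargc : |(starRingEnd ℂ c).arg| < θ₀ := by
    rw [Complex.arg_conj, if_neg (Complex.slitPlane_arg_ne_pi hc), abs_neg]
    linarith
  obtain ⟨B₁, hB₁⟩ := exists_norm_stripKernel_horizontal_le h0 (by linarith : |c.arg| < θ₀) a b
  obtain ⟨B₂, hB₂⟩ := exists_norm_stripKernel_horizontal_le h0 hargc a b
  obtain ⟨g, hg, hgb⟩ := exists_bound_stripQuotient_horizontal (a := a) (b := b) h0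
  have hW {x θ : ℝ} (hθ : θ ∈ Set.Ioo θ₀ Real.pi) : stripQuotient (x - θ * Complex.I) =
      starRingEnd ℂ (stripQuotient (x + θ * Complex.I)) := by
    rw [← conj_add_mul_I, stripQuotient_conj]
    have : |θ| < Real.pi := by rw [abs_of_pos (h0.trans hθ.1)]; exact hθ.2
    simpa using this
  have hIoo : Set.Ioo θ₀ Real.pi ∈ nhdsWithin Real.pi (Set.Iio Real.pi) := Ioo_mem_nhdsLT hθπ
  refine intervalIntegral.tendsto_integral_filter_of_dominated_convergence
    (fun x => (g x + ‖q‖) * B₂ + (g x + ‖q‖) * B₁) ?_ ?_ ?_ ?_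
  · have hH : Measurable H := (measurable_stripQuotient.sub_const q).mul (measurable_stripKernel c)
    exact Filter.Eventually.of_forall fun θ => Measurable.aestronglyMeasurable
      ((hH.comp (by fun_prop)).sub (hH.comp (by fun_prop)))
  · filter_upwards [hIoo] with θ hθ
    filter_upwards [ae_exp_ne_natCast] with x hx hxab
    rw [Set.uIoc_of_le hab] at hxab
    have hx' := Set.Ioc_subset_Icc_self hxab
    have hθ' := Set.Ioo_subset_Icc_self hθ
    have hgx := hgb x hx' hx θ hθ'
    refine (norm_sub_le _ _).trans (add_le_add ?_ ?_)
    · rw [norm_mul]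
      refine mul_le_mul ((norm_sub_le _ _).trans (add_le_add ?_ le_rfl)) ?_ (norm_nonneg _)
        (add_nonneg ((norm_nonneg _).trans hgx) (norm_nonneg _))
      · rw [hW hθ, RCLike.norm_conj]
        exact hgx
      · rw [← conj_add_mul_I, stripKernel_conj, RCLike.norm_conj]
        exact hB₂ x hx' θ hθ'
    · rw [norm_mul]
      exact mul_le_mul ((norm_sub_le _ _).trans (add_le_add hgx le_rfl)) (hB₁ x hx' θ hθ')
        (norm_nonneg _) (add_nonneg ((norm_nonneg _).trans hgx) (norm_nonneg _))
  · exact ((hg.add intervalIntegrable_const).mul_const _).add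
      ((hg.add intervalIntegrable_const).mul_const _)
  · filter_upwards [ae_exp_ne_natCast] with x hx _
    have hlim := tendsto_stripQuotient hx
    have hden : (Real.exp x : ℂ) + c ≠ 0 := by
      intro h
      rw [← eq_neg_iff_add_eq_zero, eq_comm, neg_eq_iff_eq_neg] at h
      rw [h, ← Complex.ofReal_neg, Complex.ofReal_mem_slitPlane] at hc
      linarith [Real.exp_pos x]
    have hK {d : ℂ} (hd : (Real.exp x : ℂ) + d ≠ 0) : Filter.Tendsto
        (fun θ : ℝ => stripKernel d (x + θ * Complex.I)) (nhdsWithin Real.pi (Set.Iio Real.pi))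
        (nhds (Real.exp x / (Real.exp x + d))) := by
      rw [← stripKernel_add_pi_mul_I]
      have : Continuous fun θ : ℝ => Complex.exp (x + θ * Complex.I) := by fun_prop
      refine Filter.Tendsto.mono_left ?_ nhdsWithin_le_nhds
      refine (this.tendsto Real.pi).div ((this.sub continuous_const).tendsto Real.pi) ?_
      rw [exp_add_pi_mul_I, ← neg_add']
      exact neg_ne_zero.2 hd
    have hKc : Filter.Tendsto (fun θ : ℝ => stripKernel c (x - θ * Complex.I))
        (nhdsWithin Real.pi (Set.Iio Real.pi)) (nhds (Real.exp x / (Real.exp x + c))) := by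
      have h2 : (Real.exp x : ℂ) + starRingEnd ℂ c ≠ 0 := by
        rw [← Complex.conj_ofReal, ← map_add]
        exact (map_ne_zero _).2 hden
      have := (Complex.continuous_conj.tendsto _).comp (hK h2)
      simp only [map_div₀, map_add, Complex.conj_ofReal, Complex.conj_conj] at this
      refine this.congr fun θ => ?_
      rw [Function.comp_apply, ← conj_add_mul_I, stripKernel_conj]
    have hWc : Filter.Tendsto (fun θ : ℝ => stripQuotient (x - θ * Complex.I))
        (nhdsWithin Real.pi (Set.Iio Real.pi))
        (nhds (starRingEnd ℂ (stripQuotient (x + Real.pi * Complex.I)))) := by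
      refine ((Complex.continuous_conj.tendsto _).comp hlim).congr' ?_
      filter_upwards [hIoo] with θ hθ
      exact (hW hθ).symm
    have := ((hWc.sub_const q).mul hKc).sub ((hlim.sub_const q).mul (hK hden))
    convert this using 2
    rw [← sub_mul, sub_sub_sub_cancel_right, ← neg_sub, Complex.sub_conj]
    push_cast
    ring

/-! ### Cauchy's formula and the vanishing of the vertical edges. -/

/-- The density of the Stieltjes representation, as given by the boundary values of
`barnesQuotient` on the cut. -/
noncomputable def cutDensity (t : ℝ) : ℝ := (barnesQuotient (-t)).im / Real.pi

theorem im_stripQuotient_add_pi_mul_I (x : ℝ) :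
    (stripQuotient (x + Real.pi * Complex.I)).im = Real.pi * cutDensity (Real.exp x) := by
  rw [cutDensity, ← exp_add_pi_mul_I, barnesQuotient_exp (by simp [Real.pi_pos]) (by simp),
    mul_div_cancel₀ _ Real.pi_ne_zero]

/-- Cauchy's formula on the plane cut along the negative half-line, with the circles
`‖z‖ = exp a` and `‖z‖ = exp b` as remaining boundary. -/
theorem barnesQuotient_eq {c : ℂ} (hc : c ∈ Complex.slitPlane) (hc1 : c ≠ 1) {a b : ℝ}
    (ha : Real.exp a < ‖c‖) (hb : ‖c‖ < Real.exp b) (ha0 : a < 0) (hb0 : 0 < b)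
    (hbn : ∀ k : ℕ, Real.exp b ≠ k) :
    barnesQuotient c =
      1 / 2 - (∫ x : ℝ in a..b, cutDensity (Real.exp x) * (Real.exp x / (Real.exp x + c))) +
      ((∫ y : ℝ in -Real.pi..Real.pi, (stripQuotient (b + y * Complex.I) - 1 / 2) *
          stripKernel c (b + y * Complex.I)) -
        ∫ y : ℝ in -Real.pi..Real.pi, stripQuotient (a + y * Complex.I) *
          stripKernel c (a + y * Complex.I)) / (2 * Real.pi) := by
  have hc0 : c ≠ 0 := Complex.slitPlane_ne_zero hc
  have hec : Complex.exp (Complex.log c) = c := Complex.exp_log hc0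
  have hv : Complex.log c ≠ 0 := fun h => hc1 (by rw [← hec, h, Complex.exp_zero])
  have hcn : 0 < ‖c‖ := norm_pos_iff.2 hc0
  have hav : a < (Complex.log c).re := by rwa [Complex.log_re, Real.lt_log_iff_exp_lt hcn]
  have hvb : (Complex.log c).re < b := by rwa [Complex.log_re, Real.log_lt_iff_lt_exp hcn]
  have han (k : ℕ) : Real.exp a ≠ k := by
    intro h
    have h1 : (k : ℝ) < 1 := h ▸ Real.exp_lt_one_iff.2 ha0
    have h2 : (0 : ℝ) < k := h ▸ Real.exp_pos a
    norm_cast at h1 h2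
    omega
  have harg : |(Complex.log c).im| < Real.pi := by
    rw [Complex.log_im]
    exact abs_arg_lt_pi hc
  have hq : stripQuotient (Complex.log c) = barnesQuotient c := by
    rw [← barnesQuotient_exp (Complex.neg_pi_lt_log_im c) (Complex.log_im_le_pi c), hec]
  set q := stripQuotient (Complex.log c) with hqdef
  have hI (r : ℝ) (hr0 : r ≠ 0) (hr : Real.exp r ≠ ‖c‖) (hrn : ∀ k : ℕ, Real.exp r ≠ k) (p : ℂ)
      (s t : ℝ) : IntervalIntegrable (fun y : ℝ => (stripQuotient (r + y * Complex.I) - p) *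
        stripKernel c (r + y * Complex.I)) MeasureTheory.volume s t := by
    simp only [sub_mul]
    exact (intervalIntegrable_stripQuotient_mul_vertical hr0 hr hrn s t).sub
      ((intervalIntegrable_stripKernel_vertical hr s t).const_mul p)
  have hlim := ((tendsto_horizontal hc q (ha.trans hb |> Real.exp_lt_exp.1).le).add
    ((tendsto_integral_symm Real.pi (hI b hb0.ne' hb.ne' hbn q)).const_mul Complex.I)).sub
    ((tendsto_integral_symm Real.pi (hI a ha0.ne ha.ne han q)).const_mul Complex.I)
  have hzero := tendsto_nhds_unique (hlim.congr' (f₂ := fun _ => 0) (by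
    filter_upwards [Ioo_mem_nhdsLT harg] with θ hθ
    have := strip_rect_identity hv hav hvb ha0 hb0 hθ.1 hθ.2
    rwa [hec] at this)) tendsto_const_nhds
  have hsplit (r : ℝ) (hr0 : r ≠ 0) (hr : Real.exp r ≠ ‖c‖) (hrn : ∀ k : ℕ, Real.exp r ≠ k)
      (p : ℂ) : ∫ y : ℝ in -Real.pi..Real.pi, (stripQuotient (r + y * Complex.I) - q) *
        stripKernel c (r + y * Complex.I) =
      (∫ y : ℝ in -Real.pi..Real.pi, (stripQuotient (r + y * Complex.I) - p) *
        stripKernel c (r + y * Complex.I)) -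
      (q - p) * ∫ y : ℝ in -Real.pi..Real.pi, stripKernel c (r + y * Complex.I) := by
    rw [← intervalIntegral.integral_const_mul, ← intervalIntegral.integral_sub
      (hI r hr0 hr hrn p _ _) ((intervalIntegrable_stripKernel_vertical hr _ _).const_mul _)]
    exact intervalIntegral.integral_congr fun y _ => by ring
  -- On each circle the constant `q` is replaced by the limit of the quotient there, with `0`
  -- standing in for the inner circle. The kernel integrates to `2πi` outside and to `0` inside, so
  -- `q - 1/2` is isolated.
  rw [hsplit b hb0.ne' hb.ne' hbn (1 / 2), hsplit a ha0.ne ha.ne han 0, mul_sub, mul_sub,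
    mul_left_comm Complex.I (q - 1 / 2), mul_left_comm Complex.I (q - 0),
    I_mul_integral_stripKernel_of_lt hb, I_mul_integral_stripKernel_of_gt ha] at hzero
  simp only [sub_zero, mul_zero] at hzero
  have hhor : (∫ x : ℝ in a..b, -(2 * Complex.I * (stripQuotient (x + Real.pi * Complex.I)).im) *
        (Real.exp x / (Real.exp x + c))) = -(2 * Real.pi * Complex.I) *
      ∫ x : ℝ in a..b, cutDensity (Real.exp x) * (Real.exp x / (Real.exp x + c)) := by
    rw [← intervalIntegral.integral_const_mul]
    refine intervalIntegral.integral_congr fun x _ => ?_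
    simp only [im_stripQuotient_add_pi_mul_I]
    push_cast
    ring
  have hpi : (Real.pi : ℂ) ≠ 0 := by exact_mod_cast Real.pi_ne_zero
  rw [hhor] at hzero
  rw [← hq]
  rw [← mul_left_inj' (mul_ne_zero two_ne_zero hpi)]
  rw [add_mul, div_mul_cancel₀ _ (mul_ne_zero two_ne_zero hpi)]
  apply mul_left_cancel₀ Complex.I_ne_zero
  linear_combination -hzero

theorem norm_stripQuotient_sub_half_le {C b y : ℝ} {N : ℕ}
    (hC : ∀ (N : ℕ) (ζ : ℂ), ‖ζ‖ = N + 1 / 2 →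
      ‖logBarnesG (1 + ζ) - ζ ^ 2 / 2 * Complex.log ζ‖ ≤ C * ‖ζ‖ ^ 2)
    (hb : Real.exp b = N + 1 / 2) (hb0 : 0 < b) (hy : y ∈ Set.Ioc (-Real.pi) Real.pi) :
    ‖stripQuotient (b + y * Complex.I) - 1 / 2‖ ≤ C / b := by
  set u : ℂ := b + y * Complex.I with hu
  have hn : ‖Complex.exp u‖ = Real.exp b := by simp [hu, Complex.norm_exp]
  have him : u.im = y := by simp [hu]
  have hle : b ≤ ‖u‖ := by
    have := (le_abs_self u.re).trans (Complex.abs_re_le_norm u)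
    simpa [hu] using this
  have hu0 : u ≠ 0 := norm_pos_iff.1 (hb0.trans_le hle)
  have h := hC N (Complex.exp u) (by rw [hn, hb])
  rw [Complex.log_exp (by rw [him]; exact hy.1) (by rw [him]; exact hy.2)] at h
  have e : stripQuotient u - 1 / 2 = (logBarnesG (1 + Complex.exp u) -
      Complex.exp u ^ 2 / 2 * u) / (Complex.exp u ^ 2 * u) := by
    have := Complex.exp_ne_zero u
    rw [stripQuotient, show Complex.exp (2 * u) = Complex.exp u ^ 2 from Complex.exp_nat_mul u 2]
    field_simp
  have hC0 : 0 ≤ C := by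
    have := (norm_nonneg _).trans h
    exact nonneg_of_mul_nonneg_left this (by rw [hn]; positivity)
  rw [e, norm_div, norm_mul, norm_pow]
  calc _ ≤ C * ‖Complex.exp u‖ ^ 2 / (‖Complex.exp u‖ ^ 2 * b) := by
        have : 0 < ‖Complex.exp u‖ := by rw [hn]; positivity
        gcongr
    _ = C / b := by
        have : ‖Complex.exp u‖ ≠ 0 := by rw [hn]; positivity
        field_simp

theorem tendsto_right_edge (c : ℂ) :
    Filter.Tendsto (fun N : ℕ => ∫ y : ℝ in -Real.pi..Real.pi,
      (stripQuotient (Real.log (N + 1 / 2) + y * Complex.I) - 1 / 2) *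
        stripKernel c (Real.log (N + 1 / 2) + y * Complex.I)) Filter.atTop (nhds 0) := by
  obtain ⟨C, hC0, hC⟩ := exists_norm_logBarnesG_sub_le
  have hlog : Filter.Tendsto (fun N : ℕ => Real.log ((N : ℝ) + 1 / 2)) Filter.atTop
      Filter.atTop := Real.tendsto_log_atTop.comp
        (Filter.tendsto_atTop_add_const_right _ _ tendsto_natCast_atTop_atTop)
  have hlim : Filter.Tendsto (fun N : ℕ => C / Real.log ((N : ℝ) + 1 / 2) * 2 *
      |Real.pi - -Real.pi|) Filter.atTop (nhds 0) := by
    simpa using ((hlog.const_div_atTop C).mul_const 2).mul_const |Real.pi - -Real.pi|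
  refine squeeze_zero_norm' ?_ hlim
  filter_upwards [hlog.eventually_gt_atTop 0,
    tendsto_natCast_atTop_atTop.eventually_gt_atTop (2 * ‖c‖)] with N hN hNc
  have hexp : Real.exp (Real.log ((N : ℝ) + 1 / 2)) = N + 1 / 2 := Real.exp_log (by positivity)
  have hc := norm_nonneg c
  refine intervalIntegral.norm_integral_le_of_norm_le_const fun y hy => ?_
  rw [Set.uIoc_of_le (by linarith [Real.pi_pos])] at hy
  rw [norm_mul]
  refine mul_le_mul (norm_stripQuotient_sub_half_le hC hexp hN hy)
    ((norm_stripKernel_vertical_le (by rw [hexp]; linarith) y).trans ?_) (norm_nonneg _)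
    (by positivity)
  rw [hexp, abs_of_pos (by linarith), div_le_iff₀ (by linarith)]
  linarith

theorem exists_norm_logBarnesG_one_add_le :
    ∃ C : ℝ, 0 < C ∧ ∀ᶠ ζ in nhds (0 : ℂ), ‖logBarnesG (1 + ζ)‖ ≤ C * ‖ζ‖ := by
  have hd : DifferentiableAt ℂ (fun ζ : ℂ => logBarnesG (1 + ζ)) 0 := by
    refine DifferentiableAt.comp (0 : ℂ) (g := logBarnesG) ?_ (by fun_prop)
    rw [add_zero]
    exact differentiableOn_logBarnesG.differentiableAt
      (Complex.isOpen_slitPlane.mem_nhds Complex.one_mem_slitPlane)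
  obtain ⟨C, hC, h⟩ := hd.isBigO_sub.exists_pos
  refine ⟨C, hC, ?_⟩
  filter_upwards [h.bound] with ζ hζ
  simpa [logBarnesG_one] using hζ

/-- At radius `r = exp (-N)` the quotient is `O(r / (r² N))` and the kernel `O(r)`, so the product
is `O(1/N)`. -/
theorem tendsto_left_edge {c : ℂ} (hc : c ≠ 0) :
    Filter.Tendsto (fun N : ℕ => ∫ y : ℝ in -Real.pi..Real.pi,
      stripQuotient ((-N : ℝ) + y * Complex.I) *
        stripKernel c ((-N : ℝ) + y * Complex.I)) Filter.atTop (nhds 0) := by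
  obtain ⟨C, hC0, hC⟩ := exists_norm_logBarnesG_one_add_le
  obtain ⟨ε, hε, hball⟩ := Metric.eventually_nhds_iff.1 hC
  have hc0 : 0 < ‖c‖ := norm_pos_iff.2 hc
  have hr : Filter.Tendsto (fun N : ℕ => Real.exp (-(N : ℝ))) Filter.atTop (nhds 0) :=
    Real.tendsto_exp_neg_atTop_nhds_zero.comp tendsto_natCast_atTop_atTop
  have hlim : Filter.Tendsto (fun N : ℕ => 2 * C / ‖c‖ / (N : ℝ) * |Real.pi - -Real.pi|)
      Filter.atTop (nhds 0) := by
    simpa using ((tendsto_natCast_atTop_atTop (R := ℝ)).const_div_atTop (2 * C / ‖c‖)).mul_const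
      |Real.pi - -Real.pi|
  refine squeeze_zero_norm' ?_ hlim
  filter_upwards [Filter.eventually_gt_atTop 0, hr.eventually_lt_const hε,
    hr.eventually_lt_const (half_pos hc0)] with N hN hNε hNc
  have hN' : (0 : ℝ) < N := by exact_mod_cast hN
  set r := Real.exp (-(N : ℝ)) with hrdef
  have hr0 : 0 < r := Real.exp_pos _
  refine intervalIntegral.norm_integral_le_of_norm_le_const fun y _ => ?_
  have hn : ‖Complex.exp ((-N : ℝ) + y * Complex.I)‖ = r := by simp [Complex.norm_exp, r]
  have hL := hball (y := Complex.exp ((-N : ℝ) + y * Complex.I)) (by rwa [dist_zero_right, hn])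
  rw [hn] at hL
  have hre : (((-N : ℝ) : ℂ) + y * Complex.I).re = -N := by simp
  have hle : (N : ℝ) ≤ ‖((-N : ℝ) : ℂ) + y * Complex.I‖ := by
    have := (neg_le_abs _).trans (Complex.abs_re_le_norm (((-N : ℝ) : ℂ) + y * Complex.I))
    rwa [hre, neg_neg] at this
  have hW := norm_stripQuotient_le (norm_pos_iff.1 (hN'.trans_le hle)) hL
  have hrc : r ≠ ‖c‖ := by linarith
  have hK : ‖stripKernel c ((-N : ℝ) + y * Complex.I)‖ ≤ 2 * r / ‖c‖ := by
    refine (norm_stripKernel_vertical_le hrc y).trans ?_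
    rw [← hrdef, abs_of_neg (by linarith), div_le_div_iff₀ (by linarith) hc0]
    nlinarith
  have hW' : ‖stripQuotient ((-N : ℝ) + y * Complex.I)‖ ≤ C / (r * N) := by
    have e : Real.exp (2 * -(N : ℝ)) = r ^ 2 := by rw [hrdef, ← Real.exp_nat_mul]; norm_num
    rw [hre, e] at hW
    refine hW.trans ?_
    rw [div_le_div_iff₀ (mul_pos (by positivity) (hN'.trans_le hle)) (by positivity)]
    have := mul_le_mul_of_nonneg_left hle (by positivity : 0 ≤ C * r ^ 2)
    linarith
  rw [norm_mul]
  refine (mul_le_mul hW' hK (norm_nonneg _) (by positivity)).trans (le_of_eq ?_)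
  field_simp

/-- The Stieltjes representation in the form of a limit of integrals over compact intervals. -/
theorem tendsto_integral_cutDensity {c : ℂ} (hc : c ∈ Complex.slitPlane) (hc1 : c ≠ 1) :
    Filter.Tendsto (fun N : ℕ => ∫ x : ℝ in (-N : ℝ)..Real.log (N + 1 / 2),
      (cutDensity (Real.exp x) : ℂ) * (Real.exp x / (Real.exp x + c))) Filter.atTop
      (nhds (1 / 2 - barnesQuotient c)) := by
  have hc0 : c ≠ 0 := Complex.slitPlane_ne_zero hc
  have hlim := (((tendsto_right_edge c).sub (tendsto_left_edge hc0)).div_const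
    (2 * (Real.pi : ℂ))).const_add (1 / 2 - barnesQuotient c)
  rw [sub_zero, zero_div, add_zero] at hlim
  have hr : Filter.Tendsto (fun N : ℕ => Real.exp (-(N : ℝ))) Filter.atTop (nhds 0) :=
    Real.tendsto_exp_neg_atTop_nhds_zero.comp tendsto_natCast_atTop_atTop
  refine hlim.congr' ?_
  filter_upwards [Filter.eventually_gt_atTop 0,
    hr.eventually_lt_const (norm_pos_iff.2 hc0),
    tendsto_natCast_atTop_atTop.eventually_gt_atTop ‖c‖] with N hN hNa hNb
  have hN' : (1 : ℝ) ≤ N := by exact_mod_cast hN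
  have hexp : Real.exp (Real.log ((N : ℝ) + 1 / 2)) = N + 1 / 2 := Real.exp_log (by positivity)
  have h := barnesQuotient_eq hc hc1 (a := -N) (b := Real.log (N + 1 / 2)) hNa
    (by rw [hexp]; linarith) (by linarith) (Real.log_pos (by linarith)) fun k hk => by
      rw [hexp] at hk
      have h' : 2 * N + 1 = 2 * k := by
        have : (2 * N + 1 : ℝ) = 2 * k := by linarith
        exact_mod_cast this
      omega
  linear_combination -h

/-! ### The positive density and the Stieltjes integral. -/

/-- A positive version of `cutDensity`, which differs from it only on a null set. -/
noncomputable def barnesDensity (t : ℝ) : ℝ := if 0 < cutDensity t then cutDensity t else 1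

theorem measurable_cutDensity : Measurable cutDensity := by
  have h : Measurable barnesQuotient :=
    (measurable_logBarnesG.comp (by fun_prop)).div (by fun_prop)
  exact (Complex.measurable_im.comp (h.comp (by fun_prop))).div_const _

theorem measurable_barnesDensity : Measurable barnesDensity :=
  Measurable.ite (measurableSet_lt measurable_const measurable_cutDensity)
    measurable_cutDensity measurable_const

theorem barnesDensity_pos (t : ℝ) : 0 < barnesDensity t := by
  unfold barnesDensity
  split_ifs with h
  · exact h
  · exact one_pos

theorem barnesDensity_exp {x : ℝ} (hx : ∀ k : ℕ, Real.exp x ≠ k) :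
    barnesDensity (Real.exp x) = cutDensity (Real.exp x) :=
  if_pos (div_pos (im_barnesQuotient_neg_pos (Real.exp_pos x) hx) Real.pi_pos)

theorem intervalIntegrable_cutDensity_exp (a b : ℝ) :
    IntervalIntegrable (fun x => cutDensity (Real.exp x)) MeasureTheory.volume a b := by
  wlog hab : a ≤ b generalizing a b
  · exact (this b a (not_le.1 hab).le).symm
  obtain ⟨g, hg, hgb⟩ := exists_bound_stripQuotient_horizontal (a := a) (b := b) Real.pi_pos
  refine (hg.div_const Real.pi).mono_fun'
    (measurable_cutDensity.comp Real.measurable_exp).aestronglyMeasurable ?_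
  rw [Filter.EventuallyLE, MeasureTheory.ae_restrict_iff' measurableSet_uIoc]
  filter_upwards [ae_exp_ne_natCast] with x hx hxab
  rw [Set.uIoc_of_le hab] at hxab
  have h := hgb x (Set.Ioc_subset_Icc_self hxab) hx Real.pi ⟨le_rfl, le_rfl⟩
  rw [le_div_iff₀ Real.pi_pos, ← Real.norm_of_nonneg Real.pi_pos.le, ← norm_mul, mul_comm,
    ← im_stripQuotient_add_pi_mul_I]
  exact (Complex.abs_im_le_norm _).trans h

theorem tendsto_log_natCast_add_half :
    Filter.Tendsto (fun N : ℕ => Real.log ((N : ℝ) + 1 / 2)) Filter.atTop Filter.atTop :=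
  Real.tendsto_log_atTop.comp
    (Filter.tendsto_atTop_add_const_right _ _ tendsto_natCast_atTop_atTop)

/-- For a nonnegative integrand, convergence over exhausting intervals yields integrability. The
point `c = 2` is a convenient positive choice other than the excluded `1`, and supplies the
reference weight `1/(t + 2)`. -/
theorem integrable_barnesDensity_exp :
    MeasureTheory.Integrable fun x : ℝ =>
      Real.exp x • (barnesDensity (Real.exp x) / (Real.exp x + 2)) := by
  have ha : Filter.Tendsto (fun N : ℕ => -(N : ℝ)) Filter.atTop Filter.atBot :=
    Filter.tendsto_neg_atTop_atBot.comp tendsto_natCast_atTop_atTop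
  have hab : ∀ᶠ N : ℕ in Filter.atTop, -(N : ℝ) ≤ Real.log ((N : ℝ) + 1 / 2) := by
    filter_upwards [tendsto_log_natCast_add_half.eventually_ge_atTop 0] with N hN
    linarith [(Nat.cast_nonneg N : (0 : ℝ) ≤ N)]
  have hae : (fun x : ℝ => cutDensity (Real.exp x) * (Real.exp x / (Real.exp x + 2))) =ᵐ[
      MeasureTheory.volume] fun x : ℝ =>
        Real.exp x • (barnesDensity (Real.exp x) / (Real.exp x + 2)) := by
    filter_upwards [ae_exp_ne_natCast] with x hx
    rw [barnesDensity_exp hx, smul_eq_mul]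
    ring
  have hint (a b : ℝ) : IntervalIntegrable
      (fun x : ℝ => cutDensity (Real.exp x) * (Real.exp x / (Real.exp x + 2)))
      MeasureTheory.volume a b :=
    (intervalIntegrable_cutDensity_exp a b).mul_continuousOn
      (Continuous.continuousOn (by fun_prop (disch := intro x; positivity)))
  have hlim := (Complex.continuous_re.tendsto _).comp (tendsto_integral_cutDensity (c := 2)
    (by simp) (by norm_num))
  have hre (a b : ℝ) : (∫ x : ℝ in a..b,
      (cutDensity (Real.exp x) : ℂ) * (Real.exp x / (Real.exp x + 2))).re =
        ∫ x : ℝ in a..b, cutDensity (Real.exp x) * (Real.exp x / (Real.exp x + 2)) := by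
    rw [← Complex.ofReal_re (∫ x : ℝ in a..b, _), ← intervalIntegral.integral_ofReal]
    push_cast
    rfl
  simp only [Function.comp_def, hre] at hlim
  refine MeasureTheory.Integrable.congr ?_ hae
  refine (MeasureTheory.aecover_Ioc ha tendsto_log_natCast_add_half)
    |>.integrable_of_integral_tendsto_of_nonneg_ae _ (fun N => (hint _ _).1) ?_
    (hlim.congr' ?_)
  · filter_upwards [hae] with x hx
    rw [hx]
    have := barnesDensity_pos (Real.exp x)
    exact mul_nonneg (Real.exp_pos x).le (by positivity)
  · filter_upwards [hab] with N hN
    rw [intervalIntegral.integral_of_le hN]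

theorem integrableOn_barnesDensity :
    MeasureTheory.IntegrableOn (fun t : ℝ => barnesDensity t / (t + 2)) (Set.Ioi 0) := by
  have h := MeasureTheory.integrableOn_image_iff_integrableOn_abs_deriv_smul
    MeasurableSet.univ (fun x _ => (Real.hasDerivAt_exp x).hasDerivWithinAt)
    Real.exp_injective.injOn (fun t : ℝ => barnesDensity t / (t + 2))
  rw [Set.image_univ, Real.range_exp] at h
  rw [h, MeasureTheory.integrableOn_univ]
  simpa only [abs_of_pos (Real.exp_pos _)] using integrable_barnesDensity_exp

theorem norm_barnesDensity_div_le {δ t : ℝ} {z : ℂ} (hδ : 0 < δ) (ht : 0 < t)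
    (h : δ ≤ ‖(t : ℂ) + z‖) :
    ‖(barnesDensity t : ℂ) / (t + z)‖ ≤ (1 + (‖z‖ + 2) / δ) * (barnesDensity t / (t + 2)) := by
  have hd := barnesDensity_pos t
  have h0 : 0 < ‖(t : ℂ) + z‖ := hδ.trans_le h
  have h1 : t ≤ ‖(t : ℂ) + z‖ + ‖z‖ := by
    have := norm_sub_le ((t : ℂ) + z) z
    rwa [add_sub_cancel_right, Complex.norm_real, Real.norm_of_nonneg ht.le] at this
  have h2 : ‖z‖ + 2 ≤ (‖z‖ + 2) / δ * ‖(t : ℂ) + z‖ := by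
    rw [div_mul_eq_mul_div, le_div_iff₀ hδ]
    gcongr
  rw [norm_div, Complex.norm_real, Real.norm_of_nonneg hd.le, ← mul_div_assoc,
    div_le_div_iff₀ h0 (by linarith)]
  nlinarith

theorem exists_le_norm_ofReal_add {z : ℂ} (hz : z ∈ Complex.slitPlane) :
    ∃ δ : ℝ, 0 < δ ∧ ∀ t : ℝ, 0 < t → δ ≤ ‖(t : ℂ) + z‖ := by
  rcases Complex.mem_slitPlane_iff.1 hz with h | h
  · refine ⟨z.re, h, fun t ht => ?_⟩
    have := (le_abs_self _).trans (Complex.abs_re_le_norm ((t : ℂ) + z))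
    simp at this
    linarith
  · refine ⟨|z.im|, abs_pos.2 h, fun t _ => ?_⟩
    simpa using Complex.abs_im_le_norm ((t : ℂ) + z)

theorem aestronglyMeasurable_barnesDensity_div (z : ℂ) :
    MeasureTheory.AEStronglyMeasurable (fun t : ℝ => (barnesDensity t : ℂ) / ((t : ℂ) + z))
      (MeasureTheory.volume.restrict (Set.Ioi 0)) :=
  ((Complex.measurable_ofReal.comp measurable_barnesDensity).div
    (by fun_prop)).aestronglyMeasurable

theorem integrableOn_barnesDensity_div {z : ℂ} (hz : z ∈ Complex.slitPlane) :
    MeasureTheory.IntegrableOn (fun t : ℝ => (barnesDensity t : ℂ) / ((t : ℂ) + z))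
      (Set.Ioi 0) := by
  obtain ⟨δ, hδ, h⟩ := exists_le_norm_ofReal_add hz
  refine (integrableOn_barnesDensity.const_mul (1 + (‖z‖ + 2) / δ)).mono'
    (aestronglyMeasurable_barnesDensity_div z) ?_
  rw [MeasureTheory.ae_restrict_iff' measurableSet_Ioi]
  exact Filter.Eventually.of_forall fun t ht => norm_barnesDensity_div_le hδ ht (h t ht)

theorem barnesQuotient_eq_sub_integral {z : ℂ} (hz : z ∈ Complex.slitPlane) (hz1 : z ≠ 1) :
    barnesQuotient z =
      1 / 2 - ∫ t in Set.Ioi (0 : ℝ), (barnesDensity t : ℂ) / ((t : ℂ) + z) := by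
  have hint := integrableOn_barnesDensity_div hz
  have h1 := MeasureTheory.integrableOn_image_iff_integrableOn_abs_deriv_smul
    MeasurableSet.univ (fun x _ => (Real.hasDerivAt_exp x).hasDerivWithinAt)
    Real.exp_injective.injOn (fun t : ℝ => (barnesDensity t : ℂ) / ((t : ℂ) + z))
  have h2 := MeasureTheory.integral_image_eq_integral_abs_deriv_smul
    MeasurableSet.univ (fun x _ => (Real.hasDerivAt_exp x).hasDerivWithinAt)
    Real.exp_injective.injOn (fun t : ℝ => (barnesDensity t : ℂ) / ((t : ℂ) + z))
  simp only [Set.image_univ, Real.range_exp, MeasureTheory.integrableOn_univ,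
    MeasureTheory.setIntegral_univ, abs_of_pos (Real.exp_pos _), Complex.real_smul] at h1 h2
  have hae : (fun x : ℝ => (Real.exp x : ℂ) * ((barnesDensity (Real.exp x) : ℂ) /
      ((Real.exp x : ℂ) + z))) =ᵐ[MeasureTheory.volume] fun x : ℝ =>
        (cutDensity (Real.exp x) : ℂ) * (Real.exp x / (Real.exp x + z)) := by
    filter_upwards [ae_exp_ne_natCast] with x hx
    rw [barnesDensity_exp hx]
    ring
  have hlim := MeasureTheory.intervalIntegral_tendsto_integral ((h1.1 hint).congr hae)
    (Filter.tendsto_neg_atTop_atBot.comp tendsto_natCast_atTop_atTop)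
    tendsto_log_natCast_add_half
  rw [← MeasureTheory.integral_congr_ae hae, ← h2] at hlim
  rw [tendsto_nhds_unique hlim (tendsto_integral_cutDensity hz hz1), sub_sub_cancel]

theorem continuousAt_integral_barnesDensity :
    ContinuousAt (fun z : ℂ => ∫ t in Set.Ioi (0 : ℝ), (barnesDensity t : ℂ) / ((t : ℂ) + z)) 1 := by
  have hre : ∀ᶠ z : ℂ in nhds 1, 1 / 2 < z.re :=
    Complex.continuous_re.continuousAt.eventually_const_lt (by norm_num)
  have hnorm : ∀ᶠ z : ℂ in nhds 1, ‖z‖ < 2 :=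
    continuous_norm.continuousAt.eventually_lt_const (by norm_num)
  refine MeasureTheory.continuousAt_of_dominated
    (Filter.Eventually.of_forall aestronglyMeasurable_barnesDensity_div)
    -- `9 = 1 + (2 + 2)/(1/2)`, from `‖z‖ < 2` and `δ = 1/2` in `norm_barnesDensity_div_le`.
    (bound := fun t => 9 * (barnesDensity t / (t + 2))) ?_
    (integrableOn_barnesDensity.const_mul 9) ?_
  · filter_upwards [hre, hnorm] with z hz hz2
    rw [MeasureTheory.ae_restrict_iff' measurableSet_Ioi]
    refine Filter.Eventually.of_forall fun t ht => ?_
    have ht' : 0 < t := ht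
    have hle : 1 / 2 ≤ ‖(t : ℂ) + z‖ := by
      have := (le_abs_self _).trans (Complex.abs_re_le_norm ((t : ℂ) + z))
      simp at this
      linarith
    refine (norm_barnesDensity_div_le (by norm_num) ht' hle).trans ?_
    have := barnesDensity_pos t
    refine mul_le_mul_of_nonneg_right ?_ (by positivity)
    linarith
  · rw [MeasureTheory.ae_restrict_iff' measurableSet_Ioi]
    refine Filter.Eventually.of_forall fun t ht => ?_
    have ht' : (0 : ℝ) < t := ht
    refine ContinuousAt.div (by fun_prop) (by fun_prop) ?_
    exact_mod_cast (by positivity : t + 1 ≠ 0)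

/-! ### The Nevanlinna–Pick property and the conclusion. -/

theorem im_barnesQuotient_nonneg {z : ℂ} (hz : 0 < z.im) : 0 ≤ (barnesQuotient z).im := by
  have hs : z ∈ Complex.slitPlane := Complex.mem_slitPlane_iff.2 (Or.inr hz.ne')
  have hz1 : z ≠ 1 := by
    rintro rfl
    simp at hz
  have him : (∫ t in Set.Ioi (0 : ℝ), (barnesDensity t : ℂ) / ((t : ℂ) + z)).im ≤ 0 := by
    have := integral_im (𝕜 := ℂ) (integrableOn_barnesDensity_div hs)
    simp only [RCLike.im_to_complex] at this
    rw [← this]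
    refine MeasureTheory.integral_nonpos fun t => ?_
    rw [Complex.div_im]
    have := barnesDensity_pos t
    simp
    exact div_nonneg (by positivity) (Complex.normSq_nonneg _)
  rw [barnesQuotient_eq_sub_integral hs hz1, Complex.sub_im]
  simp
  linarith

theorem isNevanlinnaPick_barnesQuotient : IsNevanlinnaPick barnesQuotient := by
  refine ⟨fun z hz => ?_, fun z hz => im_barnesQuotient_nonneg hz⟩
  have hz' : 0 < z.im := hz
  have hs : z ∈ Complex.slitPlane := Complex.mem_slitPlane_iff.2 (Or.inr hz'.ne')
  have hlog : Complex.log z ≠ 0 := fun h => by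
    have := Complex.exp_log (Complex.slitPlane_ne_zero hs)
    rw [h, Complex.exp_zero] at this
    rw [← this] at hz'
    simp at hz'
  have hG : DifferentiableAt ℂ (fun z => logBarnesG (z + 1)) z := by
    refine DifferentiableAt.comp z (g := logBarnesG) ?_ (by fun_prop)
    refine differentiableOn_logBarnesG.differentiableAt (Complex.isOpen_slitPlane.mem_nhds ?_)
    rw [add_comm]
    exact one_add_mem_slitPlane hs
  exact (hG.div ((by fun_prop : DifferentiableAt ℂ (fun z : ℂ => z ^ 2) z).mul
    (Complex.differentiableAt_log hs)) (mul_ne_zero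
      (pow_ne_zero 2 (Complex.slitPlane_ne_zero hs)) hlog)).differentiableWithinAt

theorem mainTheorem6 :
    IsNevanlinnaPick (fun z : ℂ => logBarnesG (z + 1) / (z ^ 2 * Complex.log z)) ∧
    ∃ d : ℝ → ℝ,
      Measurable d ∧
      (∀ t : ℝ, 0 < t → 0 < d t) ∧
      (∀ z ∈ Complex.slitPlane,
        MeasureTheory.IntegrableOn (fun t : ℝ => (d t : ℂ) / ((t : ℂ) + z)) (Set.Ioi 0)) ∧
      (∀ z ∈ Complex.slitPlane, z ≠ 1 →
        logBarnesG (z + 1) / (z ^ 2 * Complex.log z) =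
          1 / 2 - ∫ t in Set.Ioi (0 : ℝ), (d t : ℂ) / ((t : ℂ) + z)) ∧
      Filter.Tendsto (fun z : ℂ => logBarnesG (z + 1) / (z ^ 2 * Complex.log z))
        (nhdsWithin 1 {1}ᶜ)
        (nhds (1 / 2 - ∫ t in Set.Ioi (0 : ℝ), (d t : ℂ) / ((t : ℂ) + 1))) := by
  refine ⟨isNevanlinnaPick_barnesQuotient, barnesDensity, measurable_barnesDensity,
    fun t _ => barnesDensity_pos t, fun z hz => integrableOn_barnesDensity_div hz,
    fun z hz hz1 => barnesQuotient_eq_sub_integral hz hz1, ?_⟩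
  refine ((tendsto_const_nhds.sub continuousAt_integral_barnesDensity.tendsto).mono_left
    nhdsWithin_le_nhds).congr' ?_
  filter_upwards [self_mem_nhdsWithin, mem_nhdsWithin_of_mem_nhds
    (Complex.isOpen_slitPlane.mem_nhds Complex.one_mem_slitPlane)] with z hz1 hz
  exact (barnesQuotient_eq_sub_integral hz hz1).symm
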